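/- Let $K$ be a field, let $X$ be a finite set and let $\Gamma$ be the free group on $X$, with word length $\ell$. A \emph{series} over $\Gamma$ is a function $a\colon\Gamma\to K$, $\omega\mapsto(a,\omega)$; its support is $\{\omega : (a,\omega)\ne 0\}$. The Cauchy product $ab$, $(ab,\omega)=\sum_{\alpha\beta=\omega}(a,\alpha)(b,\beta)$, is \emph{well-defined} if for every $\omega\in\Gamma$ this sum has only finitely many nonzero terms. The star $a^*=1+a+a^2+\cdots$ is \emph{well-defined} if for every $\omega\in\Gamma$ there are only finitely many tuples $(\omega_1,\dots,\omega_n)$, $n\ge 0$, with $\omega_1\cdots\omega_n=\omega$ and $(a,\omega_1)\cdots(a,\omega_n)\neq 0$; then $(a^*,\omega)$ is the sum of these products. A \emph{$*$-rational expression} is built by sums, products and stars from monomials $c\,w$, where $c\in K$ and $w$ is a (not necessarily reduced) word in the letters $x, x^{-1}$ ($x\in X$). It is \emph{well-defined} if all products and stars occurring in it are well-defined; it then represents a series over $\Gamma$. Two well-defined expressions are \emph{equivalent} if they represent the same series. Expressions \emph{without simplification} are defined recursively: a monomial $c\,w$ is one if the word $w$ is reduced; $e_1+e_2$ is one if $e_1$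 and $e_2$ are; $e_1\cdot e_2$ is one if $e_1$ and $e_2$ are and $\ell(\alpha\beta)=\ell(\alpha)+\ell(\beta)$ for all $\alpha$ in the support of the series of $e_1$ and all $\beta$ in the support of the series of $e_2$; $e^*$ is one if $e$ is, the star of the series of $e$ is well-defined, and $e\cdot e$ is an expression without simplification. \textbf{Theorem.} (1) Every well-defined $*$-rational expression $e$ has an equivalent well-defined $*$-rational expression $e'$ without simplification. (2) Such an $e'$ is effectively computable from $e$: if $K$ is a computable field (its elements are coded by natural numbers so that equality is decidable and the field operations are computable on the codes), then there is an algorithm, i.e. a partial recursive function on written expressions depending only on $K$ and $X$, which on every well-defined $*$-rational expression $e$ halts and outputs an equivalent well-defined $*$-rational expression $e'$ without simplification. -/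

import Mathlib

/-- A formal series over the free group on `X` with coefficients in `K`: an arbitrary function;
`a ω` is the coefficient of `ω`. -/
abbrev FGSeries (K X : Type*) := FreeGroup X → K

namespace FGSeries

variable {K X : Type*} [Field K]

/-- The Cauchy product `a · b` is well-defined: every coefficient is a finite sum. -/
def MulDefined (a b : FGSeries K X) : Prop :=
  ∀ ω : FreeGroup X,
    {p : FreeGroup X × FreeGroup X | p.1 * p.2 = ω ∧ a p.1 * b p.2 ≠ 0}.Finite

/-- The Cauchy product, `(ab, ω) = ∑_{αβ = ω} (a, α)(b, β)`
(meaningful when `MulDefined a b` holds). -/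
noncomputable def cauchyMul (a b : FGSeries K X) : FGSeries K X := fun ω =>
  ∑ᶠ p ∈ {p : FreeGroup X × FreeGroup X | p.1 * p.2 = ω}, a p.1 * b p.2

/-- The star `a^* = 1 + a + a² + ⋯` is well-defined: every `ω` has only finitely many
factorizations `ω = ω₁ ⋯ ωₙ` (of any length `n ≥ 0`) with `(a, ω₁) ⋯ (a, ωₙ) ≠ 0`. -/
def StarDefined (a : FGSeries K X) : Prop :=
  ∀ ω : FreeGroup X, {l : List (FreeGroup X) | l.prod = ω ∧ (l.map a).prod ≠ 0}.Finite

/-- The star, `(a^*, ω) = ∑_{n ≥ 0} ∑_{ω₁ ⋯ ωₙ = ω} (a, ω₁) ⋯ (a, ωₙ)`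
(meaningful when `StarDefined a` holds). -/
noncomputable def star (a : FGSeries K X) : FGSeries K X := fun ω =>
  ∑ᶠ l ∈ {l : List (FreeGroup X) | l.prod = ω}, (l.map a).prod

/-- No product of a monomial of the support of `a` with one of the support of `b` simplifies:
the lengths add up. -/
def MulReduced [DecidableEq X] (a b : FGSeries K X) : Prop :=
  ∀ α β : FreeGroup X, a α ≠ 0 → b β ≠ 0 → (α * β).norm = α.norm + β.norm

end FGSeries

/-- `*`-rational expressions: built from monomials `c · w`, with `c` a scalar and `w` a
(not necessarily reduced) word in the letters `x = (x, true)` and `x⁻¹ = (x, false)`, by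
sums, products and stars. -/
inductive RatExpr (K X : Type*) where
  | monomial (c : K) (w : List (X × Bool)) : RatExpr K X
  | add (e₁ e₂ : RatExpr K X) : RatExpr K X
  | mul (e₁ e₂ : RatExpr K X) : RatExpr K X
  | star (e : RatExpr K X) : RatExpr K X

namespace RatExpr

variable {K X : Type*}

open Classical in
/-- The series over the free group represented by an expression
(meaningful when the expression is well-defined). -/
noncomputable def series [Field K] : RatExpr K X → FGSeries K X
  | monomial c w => fun ω => if ω = FreeGroup.mk w then c else 0
  | add e₁ e₂ => fun ω => e₁.series ω + e₂.series ω
  | mul e₁ e₂ => FGSeries.cauchyMul e₁.series e₂.series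
  | star e => FGSeries.star e.series

/-- An expression is well-defined if all products and stars in it are. -/
def WellDefined [Field K] : RatExpr K X → Prop
  | monomial _ _ => True
  | add e₁ e₂ => e₁.WellDefined ∧ e₂.WellDefined
  | mul e₁ e₂ => e₁.WellDefined ∧ e₂.WellDefined ∧ FGSeries.MulDefined e₁.series e₂.series
  | star e => e.WellDefined ∧ FGSeries.StarDefined e.series

/-- Expressions without simplification. -/
def WithoutSimplification [Field K] [DecidableEq X] : RatExpr K X → Prop
  | monomial _ w => FreeGroup.IsReduced w
  | add e₁ e₂ => e₁.WithoutSimplification ∧ e₂.WithoutSimplification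
  | mul e₁ e₂ => e₁.WithoutSimplification ∧ e₂.WithoutSimplification ∧
      FGSeries.MulReduced e₁.series e₂.series
  | star e => e.WithoutSimplification ∧ FGSeries.StarDefined e.series ∧
      FGSeries.MulReduced e.series e.series

/-- Symbols used to write expressions down: a monomial `c · w`, or one of the three operation
symbols `0` (sum), `1` (product), `2` (star). -/
abbrev Symbol (K X : Type*) := (K × List (X × Bool)) ⊕ Fin 3

/-- The expression written out as a string of symbols, in postfix notation. -/
def code : RatExpr K X → List (Symbol K X)
  | monomial c w => [Sum.inl (c, w)]
  | add e₁ e₂ => e₁.code ++ e₂.code ++ [Sum.inr 0]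
  | mul e₁ e₂ => e₁.code ++ e₂.code ++ [Sum.inr 1]
  | star e => e.code ++ [Sum.inr 2]

/-- Reading a string of symbols from left to right with a stack. -/
def parse : List (Symbol K X) → List (RatExpr K X) → List (RatExpr K X)
  | [], s => s
  | Sum.inl (c, w) :: r, s => parse r (monomial c w :: s)
  | Sum.inr 0 :: r, e₂ :: e₁ :: s => parse r (add e₁ e₂ :: s)
  | Sum.inr 1 :: r, e₂ :: e₁ :: s => parse r (mul e₁ e₂ :: s)
  | Sum.inr 2 :: r, e :: s => parse r (star e :: s)
  | _, s => s

theorem parse_code (e : RatExpr K X) (r : List (Symbol K X)) (s : List (RatExpr K X)) :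
    parse (e.code ++ r) s = parse r (e :: s) := by
  induction e generalizing r s with
  | monomial c w => simp [code, parse]
  | add e₁ e₂ h₁ h₂ => simp [code, h₁, h₂, parse]
  | mul e₁ e₂ h₁ h₂ => simp [code, h₁, h₂, parse]
  | star e h => simp [code, h, parse]

/-- The written form determines the expression. -/
theorem code_injective : Function.Injective (code : RatExpr K X → List (Symbol K X)) := by
  intro e e' h
  have h₁ := parse_code e [] []
  have h₂ := parse_code e' [] []
  rw [h, h₂] at h₁
  simpa [parse] using h₁.symm

end RatExpr

/-- A computable field: the elements are coded by natural numbers (through `Primcodable`), so that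
equality is decidable, and the field operations are computable on the codes. -/
structure IsComputableField (K : Type*) [Field K] [Primcodable K] : Prop where
  computable_add : Computable₂ (fun a b : K => a + b)
  computable_mul : Computable₂ (fun a b : K => a * b)
  computable_neg : Computable (fun a : K => -a)
  computable_inv : Computable (fun a : K => a⁻¹)

/-!
For a letter `y`, let the cone of `y` be the set of elements of the free group whose reduced word
begins with `y`; it is one side of the edge between `1` and `y` in the Cayley graph, which is a
tree. The rank of a series `a` across this edge is the rank of the kernel `(s, t) ↦ (a, s⁻¹ t)`,
with `t` in the cone and `s` outside of it.

*Expressions have bounded rank* (`RatExpr.WellDefined.coneRankLE`). Monomials have finite rank, and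
sums and well-defined products are subadditive: in `(ab, s⁻¹ t) = ∑ v, (a, s⁻¹ v) (b, v⁻¹ t)`, sort
the vertices `v` by the side on which they lie. A well-defined star does not increase the rank
(`FGSeries.ConeRankLE.star`): as a block matrix with respect to the two sides, `B = 1 + A B` yields
`B₁₂ = (1 - A₁₁)⁻¹ A₁₂ B₂₂`, where `1 - A₁₁` is invertible because the support of `a` has no closed
path.

*Series of bounded rank have expressions without simplification*
(`FGSeries.ConeRankLE.exists_expr`). Finitely many rows span the kernel of each letter `y`.
Together with the letters, these rows are the states of a finite automaton that reads reduced words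
and computes the coefficients of the series. Kleene's elimination of states by Arden's lemma turns
it into an expression. Every state carries the letter that was read last, so that nothing
simplifies in the products and stars that arise (`Realizable.of_system`). This is visible from the
first and last letters alone (`RatExpr.info`), and hence the expressions found meet a decidable
syntactic criterion that suffices for being well-defined and without simplification
(`RatExpr.of_info_ok`).

*The algorithm* searches for a written expression that meets the criterion and represents the same
series. A series of bounded rank that vanishes on short words is zero
(`FGSeries.ConeRankLE.eq_zero_of_short`), so that it suffices to compare finitely many
coefficients. These can be computed. In a well-defined product only factors of bounded length
contribute (`FGSeries.ConeRankLE.norm_le_of_mul_ne_zero`): the factorizations of a contributing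
factor of maximal length give a triangular submatrix, whose size is at most the rank. For a star,
apply this to the square of the star of `t a` over `K(t)`, where the variable `t` counts factors
and prevents cancellation between distinct powers. The resulting bound is uniform in the exponents,
so that a power of `a` that vanishes on a certain ball shows that all higher powers do not
contribute (`FGSeries.ConeRankLE.pow_eq_zero_of_short`).
-/

/-! ### Kernels of bounded rank -/

/-- A kernel `M : P → Q → K`, that is, a possibly infinite matrix, has rank at most `d`: it is a
product of a `P × d` matrix and a `d × Q` matrix. -/
def RankLE {P Q K : Type*} [CommSemiring K] (M : P → Q → K) (d : ℕ) : Prop :=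
  ∃ (f : P → Fin d → K) (g : Fin d → Q → K), ∀ p q, M p q = ∑ i, f p i * g i q

namespace RankLE

variable {P Q K : Type*} [Field K] {M N : P → Q → K} {d e : ℕ}

theorem of_fintype {ι : Type*} [Fintype ι] (hd : Fintype.card ι ≤ d) (f : P → ι → K)
    (g : ι → Q → K) (h : ∀ p q, M p q = ∑ i, f p i * g i q) : RankLE M d := by
  classical
  obtain ⟨e⟩ : Nonempty (ι ↪ Fin d) := by
    apply Function.Embedding.nonempty_of_card_le
    simpa using hd
  refine ⟨fun p => Function.extend e (f p) 0,
    fun j q => Function.extend e (fun i => g i q) 0 j, fun p q => ?_⟩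
  rw [h]
  refine Finset.sum_of_injOn e e.injective.injOn (by simp) ?_ ?_
  · intro j _ hj
    have : Function.extend e (f p) 0 j = 0 := Function.extend_apply' _ _ _ (by simpa using hj)
    simp [this]
  · intro i _
    simp [e.injective.extend_apply]

theorem mono (h : RankLE M d) (hde : d ≤ e) : RankLE M e := by
  obtain ⟨f, g, h⟩ := h
  exact of_fintype (by simpa using hde) f g h

theorem comp {P' Q' : Type*} (h : RankLE M d) (u : P' → P) (v : Q' → Q) :
    RankLE (fun p q => M (u p) (v q)) d := by
  obtain ⟨f, g, h⟩ := h
  exact ⟨fun p => f (u p), fun i q => g i (v q), fun p q => h _ _⟩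

theorem add (hM : RankLE M d) (hN : RankLE N e) : RankLE (fun p q => M p q + N p q) (d + e) := by
  obtain ⟨f, g, h⟩ := hM
  obtain ⟨f', g', h'⟩ := hN
  refine of_fintype (ι := Fin d ⊕ Fin e) (by simp) (fun p => Sum.elim (f p) (f' p))
    (fun i q => Sum.elim (fun i => g i q) (fun i => g' i q) i) fun p q => ?_
  simp [h, h']

theorem const_mul (c : K) (hM : RankLE M d) : RankLE (fun p q => c * M p q) d := by
  obtain ⟨f, g, h⟩ := hM
  refine ⟨fun p i => c * f p i, g, fun p q => ?_⟩
  simp [h, Finset.mul_sum, mul_assoc]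

/-- Entrywise (Hadamard) products: the rank is submultiplicative. -/
theorem hadamard (hM : RankLE M d) (hN : RankLE N e) :
    RankLE (fun p q => M p q * N p q) (d * e) := by
  obtain ⟨f, g, h⟩ := hM
  obtain ⟨f', g', h'⟩ := hN
  refine of_fintype (ι := Fin d × Fin e) (by simp) (fun p i => f p i.1 * f' p i.2)
    (fun i q => g i.1 q * g' i.2 q) fun p q => ?_
  rw [h, h', Finset.sum_mul_sum, ← Finset.sum_product']
  exact Finset.sum_congr rfl fun _ _ => by ring

/-- Multiplying on the right by a matrix with finitely many rows does not increase the rank. -/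
theorem matMul {R : Type*} (hM : RankLE M d) (F : Finset Q) (N : Q → R → K) :
    RankLE (fun p r => ∑ q ∈ F, M p q * N q r) d := by
  obtain ⟨f, g, h⟩ := hM
  refine ⟨f, fun i r => ∑ q ∈ F, g i q * N q r, fun p r => ?_⟩
  simp only [h, Finset.sum_mul, Finset.mul_sum, mul_assoc]
  exact Finset.sum_comm

/-- Multiplying on the left by a matrix with finitely many columns does not increase the rank. -/
theorem matMul_left {R : Type*} (hM : RankLE M d) (F : Finset P) (N : R → P → K) :
    RankLE (fun r q => ∑ p ∈ F, N r p * M p q) d := by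
  obtain ⟨f, g, h⟩ := hM
  refine ⟨fun r i => ∑ p ∈ F, N r p * f p i, g, fun r q => ?_⟩
  simp only [h, Finset.sum_mul, Finset.mul_sum, mul_assoc]
  exact Finset.sum_comm

theorem map {L : Type*} [Field L] (φ : K →+* L) (hM : RankLE M d) :
    RankLE (fun p q => φ (M p q)) d := by
  obtain ⟨f, g, h⟩ := hM
  exact ⟨fun p i => φ (f p i), fun i q => φ (g i q), fun p q => by simp [h]⟩

theorem transpose (hM : RankLE M d) : RankLE (fun q p => M p q) d := by
  obtain ⟨f, g, h⟩ := hM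
  exact ⟨fun q i => g i q, fun i p => f p i, fun q p => by simp [h, mul_comm]⟩

/-- A nonsingular square submatrix has size at most the rank. -/
theorem card_le_of_det_ne_zero {ι : Type*} [Fintype ι] [DecidableEq ι] (hM : RankLE M d)
    (p : ι → P) (q : ι → Q) (h : (Matrix.of fun i j => M (p i) (q j)).det ≠ 0) :
    Fintype.card ι ≤ d := by
  obtain ⟨f, g, hfg⟩ := hM
  have h1 : (Matrix.of fun i j => M (p i) (q j)) =
      (Matrix.of fun i k => f (p i) k) * (Matrix.of fun k j => g k (q j)) := by
    ext i j
    simp [Matrix.mul_apply, hfg]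
  have h2 := Matrix.rank_of_isUnit _ ((Matrix.isUnit_iff_isUnit_det _).2 (isUnit_iff_ne_zero.2 h))
  rw [← h2, h1]
  refine (Matrix.rank_mul_le_left _ _).trans ((Matrix.rank_le_card_width _).trans ?_)
  simp

/-- A triangular submatrix with nonzero diagonal has size at most the rank. -/
theorem card_le_of_triangular {ι : Type*} [Fintype ι] [LinearOrder ι] (hM : RankLE M d)
    (p : ι → P) (q : ι → Q) (hd : ∀ i, M (p i) (q i) ≠ 0)
    (ht : ∀ i j, j < i → M (p i) (q j) = 0) : Fintype.card ι ≤ d := by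
  refine hM.card_le_of_det_ne_zero p q ?_
  rw [Matrix.det_of_isUpperTriangular]
  · exact Finset.prod_ne_zero_iff.2 fun i _ => hd i
  · intro i j hij
    exact ht i j hij

/-- If all minors of size `d + 1` vanish, then finitely many rows of the kernel span all of them,
pointwise: border a maximal nonvanishing minor and take the Schur complement. -/
theorem exists_rows (h : ∀ (p : Fin (d + 1) → P) (q : Fin (d + 1) → Q),
      (Matrix.of fun i j => M (p i) (q j)).det = 0) :
    ∃ r ≤ d, ∃ (p : Fin r → P) (φ : P → Fin r → K), ∀ x y, M x y = ∑ k, φ x k * M (p k) y := by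
  classical
  let S : ℕ → Prop := fun r => ∃ (p : Fin r → P) (q : Fin r → Q),
    (Matrix.of fun i j => M (p i) (q j)).det ≠ 0
  have h0 : S 0 := ⟨Fin.elim0, Fin.elim0, by simp⟩
  obtain ⟨p, q, hdet⟩ : S (Nat.findGreatest S d) := Nat.findGreatest_spec (Nat.zero_le d) h0
  have hle : Nat.findGreatest S d ≤ d := Nat.findGreatest_le d
  have hmax : ¬ S (Nat.findGreatest S d + 1) := by
    rcases hle.lt_or_eq with hlt | heq
    · exact Nat.findGreatest_is_greatest (Nat.lt_succ_self _) hlt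
    · rw [heq]
      rintro ⟨p, q, hpq⟩
      exact hpq (h p q)
  generalize Nat.findGreatest S d = r at *
  set B : Matrix (Fin r) (Fin r) K := Matrix.of fun i j => M (p i) (q j) with hB
  have hBu : IsUnit B.det := isUnit_iff_ne_zero.2 hdet
  refine ⟨r, hle, p, fun x k => ∑ j, M x (q j) * B⁻¹ j k, fun x y => ?_⟩
  let e : Fin (r + 1) ≃ Fin r ⊕ Unit := (Fintype.equivOfCardEq (by simp))
  have hz : (Matrix.fromBlocks B (Matrix.of fun i (_ : Unit) => M (p i) y)
      (Matrix.of fun (_ : Unit) j => M x (q j)) (Matrix.of fun (_ _ : Unit) => M x y)).det = 0 := by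
    by_contra hne
    refine hmax ⟨Sum.elim p (fun _ => x) ∘ e, Sum.elim q (fun _ => y) ∘ e, ?_⟩
    rw [← Matrix.det_submatrix_equiv_self e] at hne
    convert hne using 2
    ext i j
    simp only [Matrix.of_apply, Function.comp, Matrix.submatrix_apply]
    rcases e i with a | a <;> rcases e j with b | b <;> rfl
  have := B.invertibleOfIsUnitDet hBu
  rw [Matrix.det_fromBlocks₁₁, mul_eq_zero, or_iff_right hdet] at hz
  simp only [Matrix.det_unique, Matrix.sub_apply, Matrix.of_apply, Matrix.mul_apply,
    Matrix.invOf_eq_nonsing_inv, sub_eq_zero] at hz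
  exact hz

/-- A kernel of rank at most `d` is spanned by at most `d` of its own rows. -/
theorem rows (hM : RankLE M d) :
    ∃ r ≤ d, ∃ (p : Fin r → P) (φ : P → Fin r → K), ∀ x y, M x y = ∑ k, φ x k * M (p k) y := by
  refine exists_rows fun p q => ?_
  by_contra h
  simpa using hM.card_le_of_det_ne_zero p q h

/-- The rank of a kernel is the supremum of the ranks of its finite submatrices. -/
theorem of_finite (h : ∀ (p : Fin (d + 1) → P) (q : Fin (d + 1) → Q),
    RankLE (fun i j => M (p i) (q j)) d) : RankLE M d := by
  obtain ⟨r, hr, p, φ, hφ⟩ := exists_rows (M := M) (d := d) fun p q => by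
    by_contra hne
    simpa using (h p q).card_le_of_det_ne_zero id id hne
  exact of_fintype (by simpa using hr) φ (fun k y => M (p k) y) hφ

end RankLE

/-- If the graph of the nonzero entries of a square matrix `A` has no directed cycle, then `1 - A`
is invertible. -/
theorem Matrix.isUnit_one_sub_of_acyclic {I K : Type*} [Fintype I] [DecidableEq I] [Field K]
    (A : Matrix I I K) (h : ∀ v, ¬ Relation.TransGen (fun v w => A v w ≠ 0) v v) :
    IsUnit (1 - A) := by
  rw [← Matrix.mulVec_injective_iff_isUnit]
  refine (injective_iff_map_eq_zero (1 - A).mulVecLin).2 fun x hx => ?_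
  have hx' : ∀ v, x v = ∑ w, A v w * x w := fun v => by
    have := congrFun hx v
    simpa [Matrix.sub_mulVec, sub_eq_zero, Matrix.mulVec, dotProduct] using this
  let r : I → I → Prop := fun w v => Relation.TransGen (fun v w => A v w ≠ 0) v w
  have : IsTrans I r := ⟨fun _ _ _ h1 h2 => h2.trans h1⟩
  have : Std.Irrefl r := ⟨h⟩
  funext v
  induction v using (Finite.wellFounded_of_trans_of_irrefl r).induction with
  | _ v ih =>
    rw [hx' v]
    refine Finset.sum_eq_zero fun w _ => ?_
    by_cases hw : A v w = 0
    · simp [hw]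
    · simp [ih w (Relation.TransGen.single hw)]

/-! ### Reduced words and cones -/

namespace FreeGroup

variable {X : Type*}

theorem isReduced_append_iff {u v : List (X × Bool)} : IsReduced (u ++ v) ↔
    IsReduced u ∧ IsReduced v ∧ ∀ x ∈ u.getLast?, ∀ y ∈ v.head?, x.1 = y.1 → x.2 = y.2 :=
  List.isChain_append

theorem head?_invRev (w : List (X × Bool)) :
    (invRev w).head? = w.getLast?.map fun x => (x.1, !x.2) := by
  simp [invRev]

theorem getLast?_invRev (w : List (X × Bool)) :
    (invRev w).getLast? = w.head?.map fun x => (x.1, !x.2) := by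
  simp [invRev]

variable [DecidableEq X]

/-- The cone of a letter `y`: the elements whose reduced word begins with `y`. -/
def cone (y : X × Bool) : Set (FreeGroup X) := {t | t.toWord.head? = some y}

theorem IsReduced.toWord_mk {w : List (X × Bool)} (h : IsReduced w) : (mk w).toWord = w := by
  rw [FreeGroup.toWord_mk, h.reduce_eq]

theorem toWord_inv_mul_of_cone {y : X × Bool} {s t : FreeGroup X} (hs : s ∉ cone y)
    (ht : t ∈ cone y) : (s⁻¹ * t).toWord = s⁻¹.toWord ++ t.toWord := by
  rw [toWord_mul]
  refine IsReduced.reduce_eq (isReduced_append_iff.2 ⟨isReduced_toWord, isReduced_toWord, ?_⟩)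
  intro x hx z hz hxz
  rw [Option.mem_def, ht, Option.some.injEq] at hz
  subst hz
  rw [toWord_inv, getLast?_invRev] at hx
  simp only [Option.mem_def, Option.map_eq_some_iff] at hx
  obtain ⟨x', hx', rfl⟩ := hx
  by_contra hne
  refine hs ?_
  rw [cone, Set.mem_ofPred_eq, hx']
  congr 1
  ext
  · exact hxz
  · simpa using hne

theorem inv_mk_notMem_cone {u v : List (X × Bool)} {y : X × Bool} (h : IsReduced (u ++ y :: v)) :
    (mk u)⁻¹ ∉ cone y := by
  obtain ⟨hu, -, huv⟩ := isReduced_append_iff.1 h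
  intro hc
  rw [cone, Set.mem_ofPred_eq, toWord_inv, hu.toWord_mk, head?_invRev, Option.map_eq_some_iff] at hc
  obtain ⟨x, hx, rfl⟩ := hc
  simpa using huv x hx _ rfl

theorem mk_cons_mem_cone {v : List (X × Bool)} {y : X × Bool} (h : IsReduced (y :: v)) :
    mk (y :: v) ∈ cone y := by
  simp [cone, h.toWord_mk]

theorem inv_mk_mul_mem_cone {y : X × Bool} {s : FreeGroup X} (hs : s ∉ cone y) :
    (mk [y])⁻¹ * s ∈ cone (y.1, !y.2) := by
  have h := toWord_inv_mul_of_cone hs (mk_cons_mem_cone (IsReduced.singleton (a := y)))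
  have h2 : (mk [y])⁻¹ * s = (s⁻¹ * mk [y])⁻¹ := by group
  rw [cone, Set.mem_ofPred_eq, h2, toWord_inv, h, head?_invRev, IsReduced.singleton.toWord_mk]
  simp

theorem inv_mk_mul_notMem_cone {y : X × Bool} {t : FreeGroup X} (ht : t ∈ cone y) :
    (mk [y])⁻¹ * t ∉ cone (y.1, !y.2) := by
  obtain ⟨v, hv⟩ : ∃ v, t.toWord = y :: v := by
    cases h : t.toWord with
    | nil => simp [cone, h] at ht
    | cons z v =>
      simp only [cone, Set.mem_ofPred_eq, h, List.head?_cons, Option.some.injEq] at ht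
      exact ⟨v, by rw [ht]⟩
  have hr : IsReduced ([y] ++ v) := by
    rw [List.singleton_append, ← hv]
    exact isReduced_toWord
  obtain ⟨-, hv', hc⟩ := isReduced_append_iff.1 hr
  have ht2 : (mk [y])⁻¹ * t = mk v := by
    rw [← mk_toWord (x := t), hv, inv_mul_eq_iff_eq_mul, mul_mk]
    rfl
  intro h
  rw [ht2, cone, Set.mem_ofPred_eq, hv'.toWord_mk] at h
  simpa using hc y rfl _ h

theorem one_notMem_cone (y : X × Bool) : (1 : FreeGroup X) ∉ cone y := by
  simp [cone]

end FreeGroup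

/-! ### Cauchy products and stars as finite sums -/

namespace FGSeries

open FreeGroup

variable {K X : Type*} [Field K] {a b : FGSeries K X}

theorem MulDefined.finite (h : MulDefined a b) (s t : FreeGroup X) :
    {v | a (s⁻¹ * v) * b (v⁻¹ * t) ≠ 0}.Finite := by
  refine ((h (s⁻¹ * t)).image fun p => s * p.1).subset fun v hv => ?_
  exact ⟨(s⁻¹ * v, v⁻¹ * t), ⟨by simp, hv⟩, by simp⟩

/-- The coefficient of `s⁻¹ t` in a product is the sum over the intermediate vertices `v` of the
Cayley graph. -/
theorem cauchyMul_eq_sum (s t : FreeGroup X) (F : Finset (FreeGroup X))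
    (hF : ∀ v, a (s⁻¹ * v) * b (v⁻¹ * t) ≠ 0 → v ∈ F) :
    cauchyMul a b (s⁻¹ * t) = ∑ v ∈ F, a (s⁻¹ * v) * b (v⁻¹ * t) := by
  rw [← finsum_eq_sum_of_support_subset _ (s := F) (fun v hv => hF v hv), cauchyMul]
  refine (finsum_mem_eq_of_bijOn (M := K) (t := Set.univ)
    (fun p : FreeGroup X × FreeGroup X => s * p.1) ⟨fun _ _ => trivial, ?_, ?_⟩ ?_).trans
    (finsum_mem_univ _)
  · rintro ⟨p, q⟩ hp ⟨p', q'⟩ hp' h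
    simp only [mul_right_inj] at h
    subst h
    simp only [Set.mem_ofPred_eq] at hp hp'
    rw [← hp', mul_right_inj] at hp
    simp [hp]
  · intro v _
    exact ⟨(s⁻¹ * v, v⁻¹ * t), by simp, by simp⟩
  · rintro ⟨p, q⟩ hp
    simp only [Set.mem_ofPred_eq] at hp
    simp only [inv_mul_cancel_left, mul_inv_rev, mul_assoc, ← hp]

/-- The sum of the products `(a, ω₁) ⋯ (a, ωₙ)` over the factorizations `g = ω₁ ⋯ ωₙ` that belong
to a set `P` of lists. -/
noncomputable def listSum (a : FGSeries K X) (P : Set (List (FreeGroup X))) : FGSeries K X :=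
  fun g => ∑ᶠ l ∈ {l | l ∈ P ∧ l.prod = g}, (l.map a).prod

/-- The power `aᵏ` of a series whose star is well-defined. -/
noncomputable def pow (a : FGSeries K X) (k : ℕ) : FGSeries K X := listSum a {l | l.length = k}

theorem star_eq_listSum (a : FGSeries K X) : star a = listSum a Set.univ := by
  funext g
  simp [star, listSum]

theorem exists_of_listSum_ne_zero {P : Set (List (FreeGroup X))} {g : FreeGroup X}
    (h : listSum a P g ≠ 0) : ∃ l ∈ P, l.prod = g ∧ (l.map a).prod ≠ 0 := by
  obtain ⟨l, hl, h⟩ := exists_ne_zero_of_finsum_mem_ne_zero h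
  exact ⟨l, hl.1, hl.2, h⟩

/-- The finitely many factorizations of `g` that contribute to `(a^*, g)`. -/
noncomputable def StarDefined.lists (h : StarDefined a) (g : FreeGroup X) :
    Finset (List (FreeGroup X)) := (h g).toFinset

theorem StarDefined.mem_lists (h : StarDefined a) {g : FreeGroup X} {l : List (FreeGroup X)} :
    l ∈ h.lists g ↔ l.prod = g ∧ (l.map a).prod ≠ 0 :=
  (h g).mem_toFinset

theorem listSum_eq_sum (h : StarDefined a) (P : Set (List (FreeGroup X))) [DecidablePred (· ∈ P)]
    (g : FreeGroup X) : listSum a P g = ∑ l ∈ h.lists g with l ∈ P, (l.map a).prod := by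
  refine finsum_mem_eq_sum_of_inter_support_eq _ ?_
  ext l
  simp only [Set.mem_inter_iff, Set.mem_ofPred_eq, Function.mem_support, Finset.coe_filter,
    h.mem_lists]
  tauto

/-- Cutting factorizations after `i` factors. -/
theorem listSum_drop (h : StarDefined a) (i : ℕ) (P : Set (List (FreeGroup X))) :
    listSum a {l | i ≤ l.length ∧ l.drop i ∈ P} = cauchyMul (pow a i) (listSum a P) := by
  classical
  funext g
  have hg : g = (1 : FreeGroup X)⁻¹ * g := by simp
  set T := (h.lists g).filter (· ∈ {l : List (FreeGroup X) | i ≤ l.length ∧ l.drop i ∈ P})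
    with hT
  have hmem : ∀ l, l ∈ T ↔ (l.prod = g ∧ (l.map a).prod ≠ 0) ∧ i ≤ l.length ∧ l.drop i ∈ P := by
    simp only [hT, Finset.mem_filter, h.mem_lists, Set.mem_ofPred_eq, implies_true]
  conv_rhs => rw [hg]
  rw [cauchyMul_eq_sum 1 g (T.image fun l => (l.take i).prod), listSum_eq_sum h, ← hT,
    ← Finset.sum_fiberwise_of_maps_to (t := T.image fun l => (l.take i).prod)
      (g := fun l => (l.take i).prod)
      fun l hl => Finset.mem_image_of_mem _ hl]
  · refine Finset.sum_congr rfl fun p _ => ?_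
    rw [inv_one, one_mul, pow, listSum_eq_sum h, listSum_eq_sum h, Finset.sum_mul_sum,
      ← Finset.sum_product']
    refine Finset.sum_nbij' (fun l => (l.take i, l.drop i)) (fun q => q.1 ++ q.2) ?_ ?_ ?_ ?_ ?_
    · intro l hl
      obtain ⟨hlT, rfl⟩ := Finset.mem_filter.1 hl
      obtain ⟨⟨h1, h2⟩, h3, h4⟩ := (hmem l).1 hlT
      rw [← List.take_append_drop i l, List.map_append, List.prod_append] at h2
      rw [← List.take_append_drop i l, List.prod_append] at h1
      simp only [Finset.mem_product, Finset.mem_filter, h.mem_lists, Set.mem_ofPred_eq]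
      exact ⟨⟨⟨trivial, left_ne_zero_of_mul h2⟩, by simp [h3]⟩,
        ⟨by rw [← h1, inv_mul_cancel_left], right_ne_zero_of_mul h2⟩, h4⟩
    · rintro ⟨l₁, l₂⟩ hl
      simp only [Finset.mem_product, Finset.mem_filter, h.mem_lists,
        Set.mem_ofPred_eq] at hl
      obtain ⟨⟨⟨h1, h2⟩, rfl⟩, ⟨h3, h4⟩, h5⟩ := hl
      simp [hmem, h1, h2, h3, h4, h5]
    · simp
    · rintro ⟨l₁, l₂⟩ hl
      simp only [Finset.mem_product, Finset.mem_filter, h.mem_lists,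
        Set.mem_ofPred_eq] at hl
      obtain ⟨⟨-, rfl⟩, -⟩ := hl
      simp
    · intro l _
      rw [← List.prod_append, ← List.map_append, List.take_append_drop]
  · intro p hp
    rw [inv_one, one_mul] at hp
    obtain ⟨l₁, h1, h2, h3⟩ := exists_of_listSum_ne_zero (left_ne_zero_of_mul hp)
    obtain ⟨l₂, h4, h5, h6⟩ := exists_of_listSum_ne_zero (right_ne_zero_of_mul hp)
    rw [Set.mem_ofPred_eq] at h1
    refine Finset.mem_image.2 ⟨l₁ ++ l₂, ?_, by simp [← h1, h2]⟩
    simp [hmem, ← h1, h2, h3, h4, h5, h6]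

open Classical in
theorem pow_zero (a : FGSeries K X) (g : FreeGroup X) :
    pow a 0 g = if g = 1 then 1 else 0 := by
  split_ifs with hg
  · subst hg
    rw [pow, listSum, show {l : List (FreeGroup X) | l ∈ {l | l.length = 0} ∧ l.prod = 1} = {[]} by
      ext l; simp +contextual]
    simp
  · by_contra hne
    obtain ⟨l, h1, rfl, -⟩ := exists_of_listSum_ne_zero hne
    simp [List.length_eq_zero_iff.1 h1] at hg

theorem pow_one (a : FGSeries K X) : pow a 1 = a := by
  funext g
  rw [pow, listSum, show {l : List (FreeGroup X) | l ∈ {l | l.length = 1} ∧ l.prod = g} = {[g]} by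
    ext l
    simp only [Set.mem_ofPred_eq, List.length_eq_one_iff, Set.mem_singleton_iff]
    constructor
    · rintro ⟨⟨x, rfl⟩, rfl⟩
      simp
    · rintro rfl
      simp]
  simp

theorem pow_add (h : StarDefined a) (i j : ℕ) :
    pow a (i + j) = cauchyMul (pow a i) (pow a j) := by
  conv_rhs => rw [pow.eq_def a j]
  rw [← listSum_drop h, pow]
  congr 1
  ext l
  simp only [Set.mem_ofPred_eq, List.length_drop]
  omega

theorem star_eq (h : StarDefined a) (g : FreeGroup X) :
    star a g = pow a 0 g + cauchyMul a (star a) g := by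
  classical
  conv_rhs => rw [star_eq_listSum]; enter [2, 1]; rw [← pow_one a]
  rw [← listSum_drop h, star_eq_listSum, pow, listSum_eq_sum h, listSum_eq_sum h, listSum_eq_sum h,
    ← Finset.sum_filter_add_sum_filter_not _ (fun l => l.length = 0)]
  congr 1
  · refine Finset.sum_congr ?_ fun _ _ => rfl
    ext l
    simp
  · refine Finset.sum_congr ?_ fun _ _ => rfl
    ext l
    simp [Nat.one_le_iff_ne_zero]

/-- A star is the sum of the powers, and only those powers matter that do not vanish. -/
theorem star_eq_sum_pow (h : StarDefined a) (g : FreeGroup X) (n : ℕ)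
    (hn : ∀ k, n ≤ k → pow a k g = 0) : star a g = ∑ k ∈ Finset.range n, pow a k g := by
  classical
  obtain ⟨m, hm⟩ : ∃ m, ∀ l ∈ h.lists g, l.length < m :=
    ⟨(h.lists g).sup List.length + 1, fun l hl => Nat.lt_succ_of_le (Finset.le_sup hl)⟩
  have h1 : star a g = ∑ k ∈ Finset.range (max m n), pow a k g := by
    rw [star_eq_listSum, listSum_eq_sum h,
      ← Finset.sum_fiberwise_of_maps_to (t := Finset.range (max m n)) (g := List.length)]
    · refine Finset.sum_congr rfl fun k _ => ?_
      rw [pow, listSum_eq_sum h]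
      refine Finset.sum_congr ?_ fun _ _ => rfl
      ext l
      simp
    · intro l hl
      have := hm l (Finset.mem_filter.1 hl).1
      simp [this]
  rw [h1]
  symm
  refine Finset.sum_subset (by simp) fun k _ hk => hn k ?_
  simpa using hk

theorem exists_pow_eq_zero (h : StarDefined a) (g : FreeGroup X) :
    ∃ n, ∀ k, n ≤ k → pow a k g = 0 := by
  refine ⟨(h.lists g).sup List.length + 1, fun k hk => ?_⟩
  by_contra hne
  obtain ⟨l, rfl, h2, h3⟩ := exists_of_listSum_ne_zero hne
  have : l.length ≤ _ := Finset.le_sup (h.mem_lists.2 ⟨h2, h3⟩)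
  omega

theorem StarDefined.finite_splits (h : StarDefined a) (g : FreeGroup X) :
    {p : FreeGroup X × FreeGroup X | p.1 * p.2 = g ∧
      (∃ l : List (FreeGroup X), l.prod = p.1 ∧ (l.map a).prod ≠ 0) ∧
      (∃ l : List (FreeGroup X), l.prod = p.2 ∧ (l.map a).prod ≠ 0)}.Finite := by
  classical
  refine ((h.lists g).biUnion fun l => (Finset.range (l.length + 1)).image
    fun k => ((l.take k).prod, (l.drop k).prod)).finite_toSet.subset ?_
  rintro ⟨p, q⟩ ⟨hpq, ⟨l₁, h1, h2⟩, ⟨l₂, h3, h4⟩⟩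
  simp only at hpq h1 h3
  simp only [Finset.coe_biUnion, Set.mem_iUnion, Finset.mem_coe]
  refine ⟨l₁ ++ l₂, ?_, ?_⟩
  · rw [h.mem_lists, List.map_append, List.prod_append, List.prod_append, h1, h3]
    exact ⟨hpq, mul_ne_zero h2 h4⟩
  · exact Finset.mem_image.2 ⟨l₁.length, by simp, by simp [h1, h3]⟩

theorem StarDefined.mulDefined_listSum (h : StarDefined a) (P Q : Set (List (FreeGroup X))) :
    MulDefined (listSum a P) (listSum a Q) := by
  intro g
  refine (h.finite_splits g).subset ?_
  rintro ⟨p, q⟩ ⟨h1, h2⟩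
  obtain ⟨l, -, h3⟩ := exists_of_listSum_ne_zero (left_ne_zero_of_mul h2)
  obtain ⟨l', -, h4⟩ := exists_of_listSum_ne_zero (right_ne_zero_of_mul h2)
  exact ⟨h1, ⟨l, h3⟩, ⟨l', h4⟩⟩

/-- The vertex `w` of the Cayley graph can be reached from `v` by steps in the support of `a`. -/
def Reach (a : FGSeries K X) (v w : FreeGroup X) : Prop :=
  ∃ l : List (FreeGroup X), l.prod = v⁻¹ * w ∧ (l.map a).prod ≠ 0

theorem Reach.trans {u v w : FreeGroup X} (h : Reach a u v) (h' : Reach a v w) : Reach a u w := by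
  obtain ⟨l, h1, h2⟩ := h
  obtain ⟨l', h3, h4⟩ := h'
  refine ⟨l ++ l', by rw [List.prod_append, h1, h3]; group, ?_⟩
  rw [List.map_append, List.prod_append]
  exact mul_ne_zero h2 h4

theorem Reach.single {v w : FreeGroup X} (h : a (v⁻¹ * w) ≠ 0) : Reach a v w :=
  ⟨[v⁻¹ * w], by simp [h]⟩

theorem Reach.of_star_ne_zero {v w : FreeGroup X} (h : star a (v⁻¹ * w) ≠ 0) : Reach a v w := by
  rw [star_eq_listSum] at h
  obtain ⟨l, -, hl⟩ := exists_of_listSum_ne_zero h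
  exact ⟨l, hl⟩

theorem StarDefined.finite_between (h : StarDefined a) (u w : FreeGroup X) :
    {v | Reach a u v ∧ Reach a v w}.Finite := by
  refine ((h.finite_splits (u⁻¹ * w)).image fun p => u * p.1).subset ?_
  rintro v ⟨h1, h2⟩
  exact ⟨(u⁻¹ * v, v⁻¹ * w), ⟨by simp [mul_assoc], h1, h2⟩, by simp⟩

/-- The support of a series whose star is well-defined has no closed path: a closed path could be
repeated. -/
theorem StarDefined.acyclic (h : StarDefined a) (v : FreeGroup X) :
    ¬ Relation.TransGen (fun v w => a (v⁻¹ * w) ≠ 0) v v := by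
  have key : ∀ w, Relation.TransGen (fun v w => a (v⁻¹ * w) ≠ 0) v w →
      ∃ l : List (FreeGroup X), l ≠ [] ∧ l.prod = v⁻¹ * w ∧ (l.map a).prod ≠ 0 := by
    intro w hw
    induction hw with
    | @single w hw => exact ⟨[v⁻¹ * w], by simp, by simp, by simpa using hw⟩
    | @tail w w' _ hw ih =>
      obtain ⟨l, -, h2, h3⟩ := ih
      refine ⟨l ++ [w⁻¹ * w'], by simp, by simp [h2, mul_assoc], ?_⟩
      rw [List.map_append, List.prod_append]
      exact mul_ne_zero h3 (by simpa using hw)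
  intro hv
  obtain ⟨l, h1, h2, h3⟩ := key v hv
  rw [inv_mul_cancel] at h2
  refine Set.infinite_of_injective_forall_mem (f := fun n : ℕ => (List.replicate n l).flatten) ?_
    (fun n => ?_) (h 1)
  · intro m n hmn
    have := congrArg List.length hmn
    simpa [h1] using this
  · refine ⟨?_, ?_⟩
    · induction n with
      | zero => simp
      | succ n ih => simp [List.replicate_succ, h2, ih]
    · induction n with
      | zero => simp
      | succ n ih =>
        rw [List.replicate_succ, List.flatten_cons, List.map_append, List.prod_append]
        exact mul_ne_zero h3 ih

/-- The series `t a` over the field of rational functions in `t`. -/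
noncomputable def marked (a : FGSeries K X) : FGSeries (RatFunc K) X :=
  fun g => algebraMap (Polynomial K) (RatFunc K) (Polynomial.X * Polynomial.C (a g))

theorem marked_prod (a : FGSeries K X) (l : List (FreeGroup X)) :
    (l.map (marked a)).prod = algebraMap (Polynomial K) (RatFunc K)
      (Polynomial.X ^ l.length * Polynomial.C (l.map a).prod) := by
  induction l with
  | nil => simp
  | cons g l ih =>
    rw [List.map_cons, List.prod_cons, ih, marked, List.map_cons, List.prod_cons, List.length_cons,
      pow_succ, Polynomial.C_mul]
    refine (RingHom.map_mul (algebraMap (Polynomial K) (RatFunc K)) _ _).symm.trans ?_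
    congr 1
    ring

theorem marked_prod_eq_zero_iff (a : FGSeries K X) (l : List (FreeGroup X)) :
    (l.map (marked a)).prod = 0 ↔ (l.map a).prod = 0 := by
  rw [marked_prod, map_eq_zero_iff _ (RatFunc.algebraMap_injective K)]
  simp [-List.prod_eq_zero_iff]

theorem StarDefined.marked (h : StarDefined a) : StarDefined (marked a) := by
  intro g
  simpa only [ne_eq, marked_prod_eq_zero_iff] using h g

/-- The star of `t a` does not vanish where some power of `a` does not: the exponent of `t` records
the number of factors, so that distinct powers do not cancel. -/
theorem StarDefined.star_marked_ne_zero (h : StarDefined a) {k : ℕ} {g : FreeGroup X}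
    (hk : pow a k g ≠ 0) : star (FGSeries.marked a) g ≠ 0 := by
  classical
  rw [star_eq_listSum, listSum_eq_sum h.marked, Finset.filter_true_of_mem (by simp),
    show h.marked.lists g = h.lists g by
      ext l
      simp only [mem_lists, ne_eq, marked_prod_eq_zero_iff],
    Finset.sum_congr rfl fun l _ => marked_prod a l, ← map_sum]
  rw [Ne, map_eq_zero_iff _ (RatFunc.algebraMap_injective K)]
  intro h0
  apply hk
  rw [pow, listSum_eq_sum h]
  have := congrArg (fun p => Polynomial.coeff p k) h0
  simp only [Polynomial.finsetSum_coeff, Polynomial.coeff_zero, Polynomial.coeff_mul_C,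
    Polynomial.coeff_X_pow, ite_mul, one_mul, zero_mul] at this
  rw [Finset.sum_filter]
  refine Eq.trans (Finset.sum_congr rfl fun l _ => ?_) this
  simp [eq_comm]

end FGSeries

/-! ### Rank across the edges of the Cayley graph -/

namespace FGSeries

open FreeGroup

variable {K X : Type*} [Field K] [DecidableEq X] {a b : FGSeries K X} {d e : ℕ}

/-- The rank of `a` across every edge of the Cayley graph is at most `d`: for every letter `y`, the
kernel `(s, t) ↦ (a, s⁻¹ t)`, with `t` in the cone of `y` and `s` outside of it, has rank at most
`d`. -/
def ConeRankLE (a : FGSeries K X) (d : ℕ) : Prop :=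
  ∀ y : X × Bool, RankLE (fun (s : ↥(cone y)ᶜ) (t : cone y) => a ((s : FreeGroup X)⁻¹ * t)) d

namespace ConeRankLE

theorem mono (h : ConeRankLE a d) (hde : d ≤ e) : ConeRankLE a e := fun y => (h y).mono hde

theorem add (ha : ConeRankLE a d) (hb : ConeRankLE b e) :
    ConeRankLE (fun g => a g + b g) (d + e) := fun y => (ha y).add (hb y)

theorem const_mul (c : K) (ha : ConeRankLE a d) : ConeRankLE (fun g => c * a g) d :=
  fun y => (ha y).const_mul c

theorem map {L : Type*} [Field L] (φ : K →+* L) (ha : ConeRankLE a d) :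
    ConeRankLE (fun g => φ (a g)) d := fun y => (ha y).map φ

open Classical in
theorem monomial (c : K) (g : FreeGroup X) :
    ConeRankLE (fun ω => if ω = g then c else 0) (g.norm + 1) := by
  intro y
  refine ⟨fun s i => if (s : FreeGroup X)⁻¹ * mk (g.toWord.drop i) = g then c else 0,
    fun i t => if (t : FreeGroup X).toWord = g.toWord.drop i then 1 else 0, ?_⟩
  rintro ⟨s, hs⟩ ⟨t, ht⟩
  simp only
  split_ifs with h
  · have h1 := toWord_inv_mul_of_cone hs ht
    rw [h] at h1
    have h2 : g.toWord.drop s⁻¹.toWord.length = t.toWord := by simp [h1]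
    have h3 : s⁻¹.toWord.length < g.norm + 1 := by
      simp only [FreeGroup.norm, h1, List.length_append]
      omega
    rw [Finset.sum_eq_single ⟨_, h3⟩]
    · simp only [h2, mk_toWord, h, if_true, mul_one]
    · rintro ⟨i, hi⟩ _ hne
      rw [mul_ite, mul_one, mul_zero, if_neg]
      intro h4
      have h5 := congrArg List.length h4
      have h6 := congrArg List.length h1
      simp only [List.length_drop, List.length_append] at h5 h6
      refine hne (Fin.ext ?_)
      simp only
      have : 0 < t.toWord.length := by
        rw [List.length_pos_iff]
        rintro h
        simp [cone, h] at ht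
      omega
    · simp
  · symm
    refine Finset.sum_eq_zero fun i _ => ?_
    by_cases hi : t.toWord = g.toWord.drop i
    · rw [← hi, mk_toWord, if_neg h, zero_mul]
    · rw [if_neg hi, mul_zero]

/-- The intermediate vertex of a product lies on one of the two sides of the edge: the rank across
an edge is subadditive. -/
theorem cauchyMul (ha : ConeRankLE a d) (hb : ConeRankLE b e) (hab : MulDefined a b) :
    ConeRankLE (cauchyMul a b) (d + e) := by
  classical
  intro y
  refine RankLE.of_finite fun p q => ?_
  let F : Finset (FreeGroup X) := Finset.univ.biUnion fun i => Finset.univ.biUnion fun j =>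
    (hab.finite (p i : FreeGroup X) (q j)).toFinset
  have h1 := ((ha y).matMul (F.subtype (· ∈ cone y)) fun v (t : cone y) =>
    b ((v : FreeGroup X)⁻¹ * t)).comp p q
  have h2 := ((hb y).matMul_left (F.subtype (· ∈ (cone y)ᶜ)) fun (s : ↥(cone y)ᶜ) v =>
    a ((s : FreeGroup X)⁻¹ * v)).comp p q
  have h3 := h1.add h2
  convert h3 using 3 with i j
  rw [cauchyMul_eq_sum _ _ F, ← Finset.sum_filter_add_sum_filter_not _ (· ∈ cone y)]
  · congr 1
    · exact (Finset.sum_subtype_eq_sum_filter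
        (fun v : FreeGroup X => a ((p i : FreeGroup X)⁻¹ * v) * b (v⁻¹ * (q j)))).symm
    · exact (Finset.sum_subtype_eq_sum_filter (p := (· ∈ (cone y)ᶜ))
        (fun v : FreeGroup X => a ((p i : FreeGroup X)⁻¹ * v) * b (v⁻¹ * (q j)))).symm
  · intro v hv
    simp only [F, Finset.mem_biUnion, Finset.mem_univ, true_and, Set.Finite.mem_toFinset]
    exact ⟨i, j, hv⟩

end ConeRankLE

/-- Taking the star does not increase the rank across an edge. Let `A` be the restriction of the
kernel `a (v⁻¹ w)` to the vertices on the finitely many relevant paths, and let `B` be the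
corresponding part of the kernel of the star. With respect to the two sides of the edge,
`B = 1 + AB` yields `B₁₂ = (1 - A₁₁)⁻¹ A₁₂ B₂₂`. -/
theorem ConeRankLE.star (ha : ConeRankLE a d) (h : StarDefined a) : ConeRankLE (star a) d := by
  classical
  intro y
  refine RankLE.of_finite fun p q => ?_
  let F : Finset (FreeGroup X) := (Finset.univ.biUnion fun i => Finset.univ.biUnion fun j =>
    (h.finite_between (p i : FreeGroup X) (q j)).toFinset) ∪
    Finset.univ.image fun i => (p i : FreeGroup X)
  have hF : ∀ v, v ∈ F ↔ (∃ i j, Reach a (p i : FreeGroup X) v ∧ Reach a v (q j)) ∨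
      ∃ i, (p i : FreeGroup X) = v := by simp [F]
  let F₁ : Finset ↥(cone y)ᶜ := F.subtype (· ∈ (cone y)ᶜ)
  let F₂ : Finset (cone y) := F.subtype (· ∈ cone y)
  have hstep : ∀ v ∈ F₁, ∀ j, FGSeries.star a ((v : FreeGroup X)⁻¹ * q j) =
      (∑ w ∈ F₁, a ((v : FreeGroup X)⁻¹ * w) * FGSeries.star a ((w : FreeGroup X)⁻¹ * q j)) +
      ∑ w ∈ F₂, a ((v : FreeGroup X)⁻¹ * w) * FGSeries.star a ((w : FreeGroup X)⁻¹ * q j) := by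
    intro v hv j
    have hne : (v : FreeGroup X)⁻¹ * q j ≠ 1 := by
      intro h1
      rw [inv_mul_eq_one] at h1
      exact v.2 (h1 ▸ (q j).2)
    rw [star_eq h, pow_zero, if_neg hne, zero_add, cauchyMul_eq_sum _ _ F,
      ← Finset.sum_filter_add_sum_filter_not _ (· ∈ cone y), add_comm]
    · congr 1
      · exact (Finset.sum_subtype_eq_sum_filter (p := (· ∈ (cone y)ᶜ)) (fun w : FreeGroup X =>
          a ((v : FreeGroup X)⁻¹ * w) * FGSeries.star a (w⁻¹ * (q j)))).symm
      · exact (Finset.sum_subtype_eq_sum_filter (fun w : FreeGroup X =>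
          a ((v : FreeGroup X)⁻¹ * w) * FGSeries.star a (w⁻¹ * (q j)))).symm
    · intro w hw
      have h1 := Reach.single (left_ne_zero_of_mul hw)
      have h2 := Reach.of_star_ne_zero (right_ne_zero_of_mul hw)
      refine (hF w).2 (Or.inl ?_)
      rcases (hF v).1 (Finset.mem_subtype.1 hv) with ⟨i, _, h3, -⟩ | ⟨i, h3⟩
      · exact ⟨i, j, h3.trans h1, h2⟩
      · exact ⟨i, j, h3 ▸ h1, h2⟩
  let A : Matrix F₁ F₁ K := Matrix.of fun v w => a ((v : FreeGroup X)⁻¹ * w)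
  have hA : IsUnit (1 - A) := Matrix.isUnit_one_sub_of_acyclic A fun v hv =>
    h.acyclic (v : FreeGroup X) (hv.lift (fun v : F₁ => ((v : ↥(cone y)ᶜ) : FreeGroup X))
      fun _ _ h => h)
  let B : Matrix F₁ (Fin (d + 1)) K :=
    Matrix.of fun v j => FGSeries.star a ((v : FreeGroup X)⁻¹ * q j)
  let C : Matrix F₁ (Fin (d + 1)) K := Matrix.of fun v j =>
    ∑ w ∈ F₂, a ((v : FreeGroup X)⁻¹ * w) * FGSeries.star a ((w : FreeGroup X)⁻¹ * q j)
  have hBC : (1 - A) * B = C := by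
    ext v j
    rw [Matrix.sub_mul, Matrix.one_mul, Matrix.sub_apply, sub_eq_iff_eq_add', Matrix.mul_apply]
    refine (hstep v v.2 j).trans ?_
    congr 1
    exact (Finset.sum_coe_sort F₁ fun w =>
      a ((v : FreeGroup X)⁻¹ * w) * FGSeries.star a ((w : FreeGroup X)⁻¹ * q j)).symm
  have hB : B = (1 - A)⁻¹ * C := by
    rw [← hBC, Matrix.nonsing_inv_mul_cancel_left _ _ ((Matrix.isUnit_iff_isUnit_det _).1 hA)]
  have hC : RankLE (fun v j => C v j) d :=
    ((ha y).matMul F₂ fun w j => FGSeries.star a ((w : FreeGroup X)⁻¹ * q j)).comp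
      (fun v : F₁ => (v : ↥(cone y)ᶜ)) id
  have hR := hC.matMul_left Finset.univ fun v w => (1 - A)⁻¹ v w
  have hp : ∀ i, p i ∈ F₁ := fun i => Finset.mem_subtype.2 ((hF _).2 (Or.inr ⟨i, rfl⟩))
  have := hR.comp (fun i => (⟨p i, hp i⟩ : F₁)) id
  convert this using 3 with i j
  exact congrFun (congrFun hB ⟨p i, hp i⟩) j

end FGSeries

/-! ### Series of bounded rank are controlled by short words -/

namespace FGSeries

open FreeGroup

variable {K X : Type*} [Field K] [DecidableEq X] {a b : FGSeries K X} {d e : ℕ}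

theorem ConeRankLE.rankLE_swap (hb : ConeRankLE b d) (y : X × Bool) :
    RankLE (fun (s : ↥(cone y)ᶜ) (t : cone y) => b ((t : FreeGroup X)⁻¹ * s)) d := by
  have h := ((hb (y.1, !y.2)).comp (fun t : cone y => ⟨_, inv_mk_mul_notMem_cone t.2⟩)
    (fun s : ↥(cone y)ᶜ => ⟨_, inv_mk_mul_mem_cone s.2⟩)).transpose
  have hc : ∀ s t : FreeGroup X, ((mk [y])⁻¹ * t)⁻¹ * ((mk [y])⁻¹ * s) = t⁻¹ * s :=
    fun s t => by group
  simpa only [hc] using h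

/-- In a long word some letter occurs often. -/
theorem exists_letter [Finite X] (w : List (X × Bool)) (n : ℕ)
    (h : Nat.card (X × Bool) * e < w.length - n) :
    ∃ y, e < {i ∈ Finset.Ico n w.length | w[i]? = some y}.card := by
  have := Fintype.ofFinite X
  rw [Nat.card_eq_fintype_card] at h
  obtain ⟨o, ho, h⟩ := Finset.exists_lt_card_fiber_of_mul_lt_card_of_maps_to
    (s := Finset.Ico n w.length) (t := Finset.univ.map Function.Embedding.some)
    (f := fun i => w[i]?) (n := e) (fun i hi => by
      have := (Finset.mem_Ico.1 hi).2
      simp [List.getElem?_eq_getElem this]) (by simpa using h)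
  obtain ⟨y, -, rfl⟩ := Finset.mem_map.1 ho
  exact ⟨y, h⟩

theorem inv_mk_take_notMem_cone {w : List (X × Bool)} (hw : IsReduced w) {i : ℕ} {y : X × Bool}
    (hi : w[i]? = some y) : (mk (w.take i))⁻¹ ∉ cone y := by
  obtain ⟨h1, rfl⟩ := List.getElem?_eq_some_iff.1 hi
  apply inv_mk_notMem_cone (v := w.drop (i + 1))
  rwa [← List.drop_eq_getElem_cons, List.take_append_drop]

theorem mk_drop_mem_cone {w : List (X × Bool)} (hw : IsReduced w) {i : ℕ} {y : X × Bool}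
    (hi : w[i]? = some y) : mk (w.drop i) ∈ cone y := by
  obtain ⟨h1, rfl⟩ := List.getElem?_eq_some_iff.1 hi
  rw [List.drop_eq_getElem_cons h1]
  apply mk_cons_mem_cone
  rw [← List.drop_eq_getElem_cons h1]
  exact hw.infix (List.drop_suffix i w).isInfix

/-- Exchanging suffixes of a reduced word that begin with the same letter yields a reduced word. -/
theorem norm_take_mul_drop {w : List (X × Bool)} (hw : IsReduced w) {i j : ℕ} {y : X × Bool}
    (hi : w[i]? = some y) (hj : w[j]? = some y) :
    (((mk (w.take i))⁻¹)⁻¹ * mk (w.drop j)).norm = i + (w.length - j) := by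
  rw [FreeGroup.norm, toWord_inv_mul_of_cone (inv_mk_take_notMem_cone hw hi)
    (mk_drop_mem_cone hw hj), inv_inv, List.length_append,
    (hw.infix (List.take_prefix i w).isInfix).toWord_mk,
    (hw.infix (List.drop_suffix j w).isInfix).toWord_mk, List.length_take, List.length_drop,
    min_eq_left (List.getElem?_eq_some_iff.1 hi).1.le]

/-- A series of bounded rank that vanishes on short words is zero: otherwise, the factorizations of
a shortest word of the support form a triangular submatrix that is too large. -/
theorem ConeRankLE.eq_zero_of_short [Finite X] (ha : ConeRankLE a d)
    (h : ∀ ω : FreeGroup X, ω.norm ≤ Nat.card (X × Bool) * d → a ω = 0) : a = 0 := by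
  by_contra hne
  obtain ⟨ω, hω, hmin⟩ : ∃ ω, a ω ≠ 0 ∧ ∀ ω', ω'.norm < ω.norm → a ω' = 0 := by
    have hS : {ω | a ω ≠ 0}.Nonempty := Function.ne_iff.1 hne
    refine ⟨Function.argminOn FreeGroup.norm _ hS, Function.argminOn_mem FreeGroup.norm _ hS,
      fun ω' h => ?_⟩
    by_contra h'
    exact Function.not_lt_argminOn FreeGroup.norm {ω | a ω ≠ 0} h' h
  have hlen : Nat.card (X × Bool) * d < ω.toWord.length - 0 := by
    by_contra hle
    exact hω (h ω (not_lt.1 hle))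
  obtain ⟨y, hy⟩ := exists_letter ω.toWord 0 hlen
  have hw : IsReduced ω.toWord := isReduced_toWord
  set S := {i ∈ Finset.Ico 0 ω.toWord.length | ω.toWord[i]? = some y} with hS
  have hi : ∀ i : S, ω.toWord[(i : ℕ)]? = some y := fun i => (Finset.mem_filter.1 i.2).2
  have := (ha y).transpose.card_le_of_triangular (ι := S)
    (fun j => ⟨mk (ω.toWord.drop j), mk_drop_mem_cone hw (hi j)⟩)
    (fun i => ⟨(mk (ω.toWord.take i))⁻¹, inv_mk_take_notMem_cone hw (hi i)⟩)
    (fun i => by simpa [mk_toWord] using hω) (fun i j hij => by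
      refine hmin _ ?_
      rw [norm_take_mul_drop hw (hi j) (hi i), FreeGroup.norm]
      have h1 : (j : ℕ) < i := hij
      have h2 := (List.getElem?_eq_some_iff.1 (hi i)).1
      omega)
  rw [Fintype.card_coe] at this
  omega

/-- In a well-defined product of two series of bounded rank, only factors of bounded length
contribute to a coefficient: otherwise, the factorizations of a longest contributing factor form a
triangular submatrix that is too large. -/
theorem ConeRankLE.norm_le_of_mul_ne_zero [Finite X] (ha : ConeRankLE a d) (hb : ConeRankLE b d)
    (hab : MulDefined a b) {α ω : FreeGroup X} (h : a α * b (α⁻¹ * ω) ≠ 0) :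
    α.norm ≤ ω.norm + Nat.card (X × Bool) * (d * d) := by
  by_contra hlong
  obtain ⟨β, ⟨hβ, hmax⟩⟩ : ∃ β, a β * b (β⁻¹ * ω) ≠ 0 ∧
      ∀ γ, a γ * b (γ⁻¹ * ω) ≠ 0 → γ.norm ≤ β.norm := by
    have hf := hab.finite 1 ω
    simp only [inv_one, one_mul] at hf
    obtain ⟨β, h1, h2⟩ := Set.exists_max_image _ FreeGroup.norm hf ⟨α, h⟩
    exact ⟨β, h1, h2⟩
  have hlen : Nat.card (X × Bool) * (d * d) < β.toWord.length - ω.norm := by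
    have : α.norm ≤ β.toWord.length := hmax α h
    omega
  obtain ⟨y, hy⟩ := exists_letter β.toWord ω.norm hlen
  have hw : IsReduced β.toWord := isReduced_toWord
  set S := {i ∈ Finset.Ico ω.norm β.toWord.length | β.toWord[i]? = some y} with hS
  have hi : ∀ i : S, β.toWord[(i : ℕ)]? = some y := fun i => (Finset.mem_filter.1 i.2).2
  -- The cone at a prefix longer than `ω` does not contain `ω`.
  have hω : ∀ i : S, (mk (β.toWord.take i))⁻¹ * ω ∉ cone y := by
    intro i hc
    have h1 := toWord_inv_mul_of_cone (inv_mk_take_notMem_cone hw (hi i)) hc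
    rw [inv_inv, mul_inv_cancel_left,
      (hw.infix (List.take_prefix _ _).isInfix).toWord_mk] at h1
    have h2 := congrArg List.length h1
    have h3 := (Finset.mem_Ico.1 (Finset.mem_filter.1 i.2).1)
    rw [List.length_append, List.length_take, min_eq_left h3.2.le] at h2
    have h4 : 0 < ((mk (β.toWord.take i))⁻¹ * ω).toWord.length := by
      rw [List.length_pos_iff]
      intro h5
      simp only [cone, Set.mem_ofPred_eq, h5] at hc
      simp at hc
    have h5 : ω.norm = ω.toWord.length := rfl
    omega
  have h1 := (ha y).comp
    (fun i : S => ⟨(mk (β.toWord.take i))⁻¹, inv_mk_take_notMem_cone hw (hi i)⟩)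
    (fun j : S => ⟨mk (β.toWord.drop j), mk_drop_mem_cone hw (hi j)⟩)
  have h2 := (hb.rankLE_swap y).comp (fun i : S => ⟨(mk (β.toWord.take i))⁻¹ * ω, hω i⟩)
    (fun j : S => ⟨mk (β.toWord.drop j), mk_drop_mem_cone hw (hi j)⟩)
  have hinv : ∀ i j : S, (mk (β.toWord.drop j))⁻¹ * ((mk (β.toWord.take i))⁻¹ * ω) =
      (((mk (β.toWord.take i))⁻¹)⁻¹ * mk (β.toWord.drop j))⁻¹ * ω := fun i j => by group
  have := (h1.hadamard h2).card_le_of_triangular (ι := S) id id (fun i => by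
      simp only [id, hinv]
      simpa [mk_toWord] using hβ) (fun i j hij => by
      by_contra hne
      simp only [id, hinv] at hne
      have h3 := hmax _ hne
      rw [norm_take_mul_drop hw (hi i) (hi j), FreeGroup.norm] at h3
      have h4 : (j : ℕ) < i := hij
      have h5 := (List.getElem?_eq_some_iff.1 (hi i)).1
      omega)
  rw [Fintype.card_coe] at this
  omega

/-- The bound on the length of a factor of a power is uniform in the exponents. -/
theorem ConeRankLE.norm_le_of_pow_mul_pow_ne_zero [Finite X] (ha : ConeRankLE a d)
    (h : StarDefined a) {i j : ℕ} {α ω : FreeGroup X} (hi : pow a i α ≠ 0)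
    (hj : pow a j (α⁻¹ * ω) ≠ 0) : α.norm ≤ ω.norm + Nat.card (X × Bool) * (d * d) := by
  have hm : ConeRankLE (marked a) d := by
    have := (ha.map ((algebraMap (Polynomial K) (RatFunc K)).comp Polynomial.C)).const_mul
      (algebraMap (Polynomial K) (RatFunc K) Polynomial.X)
    have he : marked a = fun g => algebraMap (Polynomial K) (RatFunc K) Polynomial.X *
        algebraMap (Polynomial K) (RatFunc K) (Polynomial.C (a g)) :=
      funext fun g => RingHom.map_mul _ _ _
    rw [he]
    exact this
  have hs := hm.star h.marked
  refine hs.norm_le_of_mul_ne_zero hs ?_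
    (mul_ne_zero (h.star_marked_ne_zero hi) (h.star_marked_ne_zero hj))
  rw [star_eq_listSum]
  exact h.marked.mulDefined_listSum _ _

/-- If a power of `a` vanishes on the words that are not too long, then all higher powers vanish at
`ω`. -/
theorem ConeRankLE.pow_eq_zero_of_short [Finite X] (ha : ConeRankLE a d) (h : StarDefined a)
    {n k : ℕ} {ω : FreeGroup X}
    (hn : ∀ α : FreeGroup X, α.norm ≤ ω.norm + Nat.card (X × Bool) * (d * d) → pow a n α = 0)
    (hk : n ≤ k) : pow a k ω = 0 := by
  by_contra hne
  obtain ⟨j, rfl⟩ := Nat.exists_eq_add_of_le hk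
  rw [pow_add h, FGSeries.cauchyMul] at hne
  obtain ⟨⟨α, β⟩, hαβ, hne⟩ := exists_ne_zero_of_finsum_mem_ne_zero hne
  have hβ : β = α⁻¹ * ω := eq_inv_mul_of_mul_eq hαβ
  subst hβ
  exact left_ne_zero_of_mul hne (hn α (ha.norm_le_of_pow_mul_pow_ne_zero h
    (left_ne_zero_of_mul hne) (right_ne_zero_of_mul hne)))

end FGSeries

/-! ### Convolution of functions on words -/

/-- The Cauchy product of noncommutative power series, given by their coefficients on words. It is
defined by recursion on the word: the empty prefix is split off. -/
def wordMul {A K : Type*} [CommSemiring K] (f g : List A → K) : List A → K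
  | [] => f [] * g []
  | x :: w => f [] * g (x :: w) + wordMul (fun v => f (x :: v)) g w

section wordMul

variable {A K : Type*} [Field K]

theorem wordMul_eq_sum (f g : List A → K) (w : List A) :
    wordMul f g w = ∑ i ∈ Finset.range (w.length + 1), f (w.take i) * g (w.drop i) := by
  induction w generalizing f with
  | nil => simp [wordMul]
  | cons x w ih =>
    rw [wordMul, ih, List.length_cons, Finset.sum_range_succ' _ (w.length + 1), add_comm]
    simp

theorem wordMul_congr {f g g' : List A → K} {w : List A}
    (h : ∀ v : List A, v.length ≤ w.length → g v = g' v) : wordMul f g w = wordMul f g' w := by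
  rw [wordMul_eq_sum, wordMul_eq_sum]
  exact Finset.sum_congr rfl fun i _ => by rw [h _ (by simp)]

theorem add_wordMul (f f' g : List A → K) :
    wordMul (f + f') g = wordMul f g + wordMul f' g := by
  funext w
  simp [wordMul_eq_sum, add_mul, Finset.sum_add_distrib]

theorem wordMul_add (f g g' : List A → K) :
    wordMul f (g + g') = wordMul f g + wordMul f g' := by
  funext w
  simp [wordMul_eq_sum, mul_add, Finset.sum_add_distrib]

theorem wordMul_sum {ι : Type*} (s : Finset ι) (f : List A → K) (g : ι → List A → K) :
    wordMul f (∑ i ∈ s, g i) = ∑ i ∈ s, wordMul f (g i) := by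
  funext w
  simp only [wordMul_eq_sum, Finset.sum_apply, Finset.mul_sum]
  exact Finset.sum_comm

theorem wordMul_assoc (f g h : List A → K) :
    wordMul (wordMul f g) h = wordMul f (wordMul g h) := by
  funext w
  induction w generalizing f with
  | nil => simp [wordMul, mul_assoc]
  | cons x w ih =>
    have h1 : (fun v => wordMul f g (x :: v)) =
        (fun v => f [] * g (x :: v)) + wordMul (fun v => f (x :: v)) g := rfl
    have h2 : wordMul (fun v => f [] * g (x :: v)) h w =
        f [] * wordMul (fun v => g (x :: v)) h w := by
      simp [wordMul_eq_sum, Finset.mul_sum, mul_assoc]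
    rw [wordMul, wordMul, h1, add_wordMul, Pi.add_apply, ih, h2, wordMul, wordMul]
    ring

open Classical in
/-- The word `u` with coefficient `c`. -/
noncomputable def wordSingle (u : List A) (c : K) : List A → K := fun w => if w = u then c else 0

theorem wordSingle_nil_wordMul (g : List A → K) : wordMul (wordSingle [] 1) g = g := by
  funext w
  cases w with
  | nil => simp [wordMul, wordSingle]
  | cons x w =>
    have h : (fun v => wordSingle (K := K) [] 1 (x :: v)) = fun _ => 0 := by simp [wordSingle]
    rw [wordMul, h, wordMul_eq_sum]
    simp [wordSingle]

open Classical in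
theorem wordSingle_letter_wordMul_cons (z x : A) (c : K) (g : List A → K) (w : List A) :
    wordMul (wordSingle [z] c) g (x :: w) = if x = z then c * g w else 0 := by
  have h : (fun v => wordSingle [z] c (x :: v)) =
      fun v => (if x = z then c else 0) * wordSingle [] 1 v := by
    funext v
    simp only [wordSingle, List.cons.injEq]
    split_ifs <;> simp_all
  have h2 : wordMul (fun v => (if x = z then c else 0) * wordSingle [] 1 v) g w =
      (if x = z then c else 0) * wordMul (wordSingle [] 1) g w := by
    simp [wordMul_eq_sum, Finset.mul_sum, mul_assoc]
  rw [wordMul, h, h2, wordSingle_nil_wordMul]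
  simp [wordSingle]

/-- Arden's lemma: if `e` has no constant term and `s` is its star, the equation `g = h + e g`
has the unique solution `g = s h`. -/
theorem arden {e s g h : List A → K} (he : e [] = 0) (hs : s = wordSingle [] 1 + wordMul e s)
    (hg : g = h + wordMul e g) : g = wordMul s h := by
  have hsh : wordMul s h = h + wordMul e (wordMul s h) := by
    conv_lhs => rw [hs, add_wordMul, wordSingle_nil_wordMul, wordMul_assoc]
  funext w
  induction hn : w.length using Nat.strong_induction_on generalizing w with
  | _ n ih =>
    subst hn
    rw [hg, hsh, Pi.add_apply, Pi.add_apply]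
    congr 1
    cases w with
    | nil => simp [wordMul, he]
    | cons x w =>
      rw [wordMul, wordMul, he, zero_mul, zero_mul]
      congr 1
      refine wordMul_congr fun v hv => ih _ ?_ v rfl
      simp only [List.length_cons]
      omega

end wordMul

/-! ### A syntactic criterion for the absence of simplification -/

/-- What a syntactic analysis records about an expression: letters that contain all first and all
last letters of its support, whether the empty word may belong to the support, and whether the
criterion for the absence of simplification is met. -/
@[ext]
structure ExprInfo (X : Type*) where
  first : Set (X × Bool)
  last : Set (X × Bool)
  nullable : Prop
  ok : Prop

instance {X : Type*} [Finite X] : Finite (ExprInfo X) :=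
  Finite.of_injective (fun I : ExprInfo X => (I.first, I.last, I.nullable, I.ok)) fun I J h => by
    simp only [Prod.mk.injEq] at h
    exact ExprInfo.ext h.1 h.2.1 h.2.2.1 h.2.2.2

/-- A word that ends with a letter of `L` does not simplify with a word that begins with a letter
of `F`. -/
def Compatible {X : Type*} (L F : Set (X × Bool)) : Prop :=
  ∀ x ∈ L, ∀ y ∈ F, x.1 = y.1 → x.2 = y.2

namespace ExprInfo

variable {X : Type*}

/-- The analysis of a monomial, from its first letter, its last letter, and whether it vanishes and
is reduced. -/
def ofMonomial (zero : Prop) (h l : Option (X × Bool)) (red : Prop) : ExprInfo X where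
  first := {x | ¬ zero ∧ h = some x}
  last := {x | ¬ zero ∧ l = some x}
  nullable := ¬ zero ∧ h = none
  ok := red

/-- The analysis of a sum. -/
def add (I J : ExprInfo X) : ExprInfo X where
  first := I.first ∪ J.first
  last := I.last ∪ J.last
  nullable := I.nullable ∨ J.nullable
  ok := I.ok ∧ J.ok

/-- The analysis of a product. -/
def mul (I J : ExprInfo X) : ExprInfo X where
  first := I.first ∪ {x | I.nullable ∧ x ∈ J.first}
  last := J.last ∪ {x | J.nullable ∧ x ∈ I.last}
  nullable := I.nullable ∧ J.nullable
  ok := I.ok ∧ J.ok ∧ Compatible I.last J.first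

/-- The analysis of a star. -/
def star (I : ExprInfo X) : ExprInfo X where
  first := I.first
  last := I.last
  nullable := True
  ok := I.ok ∧ ¬ I.nullable ∧ Compatible I.last I.first

end ExprInfo

/-- The syntactic analysis of an expression. -/
def RatExpr.info {K X : Type*} [Field K] : RatExpr K X → ExprInfo X
  | monomial c w => .ofMonomial (c = 0) w.head? w.getLast? (FreeGroup.IsReduced w)
  | add e₁ e₂ => e₁.info.add e₂.info
  | mul e₁ e₂ => e₁.info.mul e₂.info
  | star e => e.info.star

namespace FGSeries

open FreeGroup

variable {K X : Type*} [Field K] [DecidableEq X] {a b : FGSeries K X} {I J : ExprInfo X}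

/-- The support of the series is as described by the syntactic analysis. -/
def SupportedBy (a : FGSeries K X) (I : ExprInfo X) : Prop :=
  ∀ ω, a ω ≠ 0 → (ω = 1 → I.nullable) ∧ (∀ x ∈ ω.toWord.head?, x ∈ I.first) ∧
    ∀ x ∈ ω.toWord.getLast?, x ∈ I.last

theorem toWord_mul_of_compatible {L F : Set (X × Bool)} (h : Compatible L F) {α β : FreeGroup X}
    (hα : ∀ x ∈ α.toWord.getLast?, x ∈ L) (hβ : ∀ x ∈ β.toWord.head?, x ∈ F) :
    (α * β).toWord = α.toWord ++ β.toWord := by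
  rw [toWord_mul]
  exact (isReduced_append_iff.2 ⟨isReduced_toWord, isReduced_toWord,
    fun x hx y hy => h x (hα x hx) y (hβ y hy)⟩).reduce_eq

theorem SupportedBy.mulReduced (ha : SupportedBy a I) (hb : SupportedBy b J)
    (h : Compatible I.last J.first) : MulReduced a b := by
  intro α β hα hβ
  rw [FreeGroup.norm, toWord_mul_of_compatible h (ha α hα).2.2 (hb β hβ).2.1, List.length_append]
  rfl

theorem finite_norm_le [Finite X] (n : ℕ) : {g : FreeGroup X | g.norm ≤ n}.Finite :=
  (List.finite_length_le (X × Bool) n).preimage toWord_injective.injOn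

theorem MulReduced.mulDefined [Finite X] (h : MulReduced a b) : MulDefined a b := by
  intro ω
  refine ((finite_norm_le ω.norm).prod (finite_norm_le ω.norm)).subset ?_
  rintro ⟨α, β⟩ ⟨rfl, h2⟩
  have := h α β (left_ne_zero_of_mul h2) (right_ne_zero_of_mul h2)
  simp only [Set.mem_prod, Set.mem_ofPred_eq]
  omega

theorem MulReduced.toWord_mul (h : MulReduced a b) {α β : FreeGroup X} (hα : a α ≠ 0)
    (hβ : b β ≠ 0) : (α * β).toWord = α.toWord ++ β.toWord :=
  (toWord_mul_sublist α β).eq_of_length (by simpa [FreeGroup.norm] using h α β hα hβ)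

/-- Nonempty words that do not simplify with each other: the word of a product is the
concatenation. -/
theorem SupportedBy.list_prod (ha : SupportedBy a I) (hn : ¬ I.nullable)
    (h : Compatible I.last I.first) {l : List (FreeGroup X)} (hl : (l.map a).prod ≠ 0) :
    l.prod.toWord = (l.map toWord).flatten ∧ (∀ x ∈ l.prod.toWord.head?, x ∈ I.first) ∧
      ∀ x ∈ l.prod.toWord.getLast?, x ∈ I.last := by
  induction l with
  | nil => simp
  | cons g l ih =>
    rw [List.map_cons, List.prod_cons] at hl
    obtain ⟨h1, h2, h3⟩ := ih (right_ne_zero_of_mul hl)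
    obtain ⟨h4, h5, h6⟩ := ha g (left_ne_zero_of_mul hl)
    have h7 := toWord_mul_of_compatible h h6 h2
    rw [List.prod_cons, h7]
    refine ⟨by simp [h1], fun x hx => ?_, fun x hx => ?_⟩
    · cases hg : g.toWord with
      | nil => exact absurd (h4 (toWord_eq_nil_iff.1 hg)) hn
      | cons y w => exact h5 x (by simpa [hg] using hx)
    · rw [List.getLast?_append, Option.mem_def, Option.or_eq_some_iff] at hx
      rcases hx with hx | ⟨-, hx⟩
      · exact h3 x hx
      · exact h6 x hx

theorem SupportedBy.starDefined [Finite X] (ha : SupportedBy a I) (hn : ¬ I.nullable)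
    (h : Compatible I.last I.first) : StarDefined a := by
  intro ω
  have hfin : Finite {g : FreeGroup X // g.norm ≤ ω.norm} := finite_norm_le ω.norm
  refine ((List.finite_length_le {g : FreeGroup X // g.norm ≤ ω.norm} ω.norm).image
    (List.map Subtype.val)).subset ?_
  rintro l ⟨rfl, hl⟩
  have h1 := (ha.list_prod hn h hl).1
  have h2 : ∀ g ∈ l, g.toWord ≠ [] := fun g hg h0 => by
    refine hn ((ha g ?_).1 (toWord_eq_nil_iff.1 h0))
    intro h3
    exact hl (List.prod_eq_zero (List.mem_map.2 ⟨g, hg, h3⟩))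
  have h3 : ∀ g ∈ l, g.norm ≤ l.prod.norm := by
    intro g hg
    rw [FreeGroup.norm, FreeGroup.norm, h1]
    exact (List.sublist_flatten_of_mem (List.mem_map_of_mem hg)).length_le
  have h4 : l.length ≤ l.prod.norm := by
    rw [FreeGroup.norm, h1, List.length_flatten, List.map_map]
    have := List.length_le_sum_of_one_le (l.map (List.length ∘ toWord)) (by
      intro n hn
      obtain ⟨g, hg, rfl⟩ := List.mem_map.1 hn
      exact List.length_pos_iff.2 (h2 g hg))
    simpa using this
  generalize l.prod.norm = n at *
  lift l to List {g : FreeGroup X // g.norm ≤ n} using h3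
  exact ⟨l, by simpa using h4, rfl⟩

theorem SupportedBy.mul (ha : SupportedBy a I) (hb : SupportedBy b J)
    (h : Compatible I.last J.first) : SupportedBy (cauchyMul a b) (I.mul J) := by
  intro ω hω
  obtain ⟨⟨α, β⟩, rfl, hne⟩ := exists_ne_zero_of_finsum_mem_ne_zero hω
  obtain ⟨h1, h2, h3⟩ := ha α (left_ne_zero_of_mul hne)
  obtain ⟨h4, h5, h6⟩ := hb β (right_ne_zero_of_mul hne)
  have h7 := toWord_mul_of_compatible h h3 h5
  rw [h7]
  refine ⟨fun h0 => ?_, fun x hx => ?_, fun x hx => ?_⟩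
  · simp only at h0
    rw [h0, toWord_one, eq_comm, List.append_eq_nil_iff, toWord_eq_nil_iff, toWord_eq_nil_iff] at h7
    exact ⟨h1 h7.1, h4 h7.2⟩
  · rw [List.head?_append, Option.mem_def, Option.or_eq_some_iff] at hx
    rcases hx with hx | ⟨h0, hx⟩
    · exact Or.inl (h2 x hx)
    · exact Or.inr ⟨h1 (toWord_eq_nil_iff.1 (List.head?_eq_none_iff.1 h0)), h5 x hx⟩
  · rw [List.getLast?_append, Option.mem_def, Option.or_eq_some_iff] at hx
    rcases hx with hx | ⟨h0, hx⟩
    · exact Or.inl (h6 x hx)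
    · exact Or.inr ⟨h4 (toWord_eq_nil_iff.1 (List.getLast?_eq_none_iff.1 h0)), h3 x hx⟩

theorem SupportedBy.star (ha : SupportedBy a I) (hn : ¬ I.nullable)
    (h : Compatible I.last I.first) : SupportedBy (star a) I.star := by
  intro ω hω
  rw [star_eq_listSum] at hω
  obtain ⟨l, -, rfl, hl⟩ := exists_of_listSum_ne_zero hω
  exact ⟨fun _ => trivial, (ha.list_prod hn h hl).2⟩

end FGSeries

namespace RatExpr

open FGSeries

variable {K X : Type*} [Field K] [DecidableEq X]

/-- The syntactic criterion is sufficient. -/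
theorem of_info_ok [Finite X] {e : RatExpr K X} (h : e.info.ok) :
    e.WellDefined ∧ e.WithoutSimplification ∧ SupportedBy e.series e.info := by
  induction e with
  | monomial c w =>
    refine ⟨trivial, h, fun ω hω => ?_⟩
    have hw : FreeGroup.IsReduced w := h
    simp only [series, ne_eq, ite_eq_right_iff, Classical.not_imp] at hω
    obtain ⟨rfl, hc⟩ := hω
    rw [hw.toWord_mk]
    refine ⟨fun h1 => ⟨hc, ?_⟩, fun x hx => ⟨hc, hx⟩, fun x hx => ⟨hc, hx⟩⟩
    rw [← FreeGroup.toWord_eq_nil_iff, hw.toWord_mk] at h1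
    simp [h1]
  | add e₁ e₂ ih₁ ih₂ =>
    obtain ⟨h1, h2, h3⟩ := ih₁ h.1
    obtain ⟨h4, h5, h6⟩ := ih₂ h.2
    refine ⟨⟨h1, h4⟩, ⟨h2, h5⟩, fun ω hω => ?_⟩
    have : e₁.series ω ≠ 0 ∨ e₂.series ω ≠ 0 := by
      by_contra! h0
      exact hω (by simp [series, h0.1, h0.2])
    rcases this with h0 | h0
    · obtain ⟨h7, h8, h9⟩ := h3 ω h0
      exact ⟨fun h => Or.inl (h7 h), fun x hx => Or.inl (h8 x hx), fun x hx => Or.inl (h9 x hx)⟩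
    · obtain ⟨h7, h8, h9⟩ := h6 ω h0
      exact ⟨fun h => Or.inr (h7 h), fun x hx => Or.inr (h8 x hx), fun x hx => Or.inr (h9 x hx)⟩
  | mul e₁ e₂ ih₁ ih₂ =>
    obtain ⟨h1, h2, h3⟩ := ih₁ h.1
    obtain ⟨h4, h5, h6⟩ := ih₂ h.2.1
    have h7 := h3.mulReduced h6 h.2.2
    exact ⟨⟨h1, h4, h7.mulDefined⟩, ⟨h2, h5, h7⟩, h3.mul h6 h.2.2⟩
  | star e ih =>
    obtain ⟨h1, h2, h3⟩ := ih h.1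
    have h4 := h3.starDefined h.2.1 h.2.2
    exact ⟨⟨h1, h4⟩, ⟨h2, h4, h3.mulReduced h3 h.2.2⟩, h3.star h.2.1 h.2.2⟩

end RatExpr

/-! ### Series of bounded rank have expressions without simplification -/

namespace FGSeries

open FreeGroup

variable {K X : Type*} [Field K] [DecidableEq X] {a b : FGSeries K X} {I J : ExprInfo X}

open Classical in
/-- A series over the free group, as a function on words that is supported by reduced words. -/
noncomputable def onWords (a : FGSeries K X) (w : List (X × Bool)) : K :=
  if IsReduced w then a (mk w) else 0

theorem onWords_injective : Function.Injective (onWords : FGSeries K X → _) := by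
  intro a b h
  funext g
  have := congrFun h g.toWord
  simpa [onWords, isReduced_toWord, mk_toWord] using this

/-- Without simplification, Cauchy products over the free group are products over words. -/
theorem MulReduced.onWords_cauchyMul [Finite X] (h : MulReduced a b) :
    onWords (cauchyMul a b) = wordMul (onWords a) (onWords b) := by
  classical
  funext w
  rw [wordMul_eq_sum]
  by_cases hw : IsReduced w
  · have h1 : ∀ i, IsReduced (w.take i) := fun i => hw.infix (List.take_prefix i w).isInfix
    have h2 : ∀ i, IsReduced (w.drop i) := fun i => hw.infix (List.drop_suffix i w).isInfix
    have h3 : ∀ i, (mk (w.take i))⁻¹ * mk w = mk (w.drop i) := fun i => by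
      rw [inv_mul_eq_iff_eq_mul, mul_mk, List.take_append_drop]
    have h4 := cauchyMul_eq_sum (a := a) (b := b) 1 (mk w)
      ((Finset.range (w.length + 1)).image fun i => mk (w.take i)) (fun v hv => by
        rw [inv_one, one_mul] at hv
        have h5 := h.toWord_mul (left_ne_zero_of_mul hv) (right_ne_zero_of_mul hv)
        rw [mul_inv_cancel_left, hw.toWord_mk] at h5
        have h6 := congrArg List.length h5
        rw [List.length_append] at h6
        refine Finset.mem_image.2 ⟨v.toWord.length, Finset.mem_range.2 (by omega), ?_⟩
        rw [h5, List.take_left, mk_toWord])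
    rw [inv_one, one_mul] at h4
    rw [onWords, if_pos hw, h4, Finset.sum_image]
    · refine Finset.sum_congr rfl fun i _ => ?_
      simp only [one_mul, h3, onWords, if_pos (h1 i), if_pos (h2 i)]
    · intro i hi j hj hij
      have h5 := congrArg (fun g => (toWord g).length) hij
      simp only [(h1 _).toWord_mk, List.length_take] at h5
      have h6 := Finset.mem_range.1 hi
      have h7 := Finset.mem_range.1 hj
      omega
  · rw [onWords, if_neg hw]
    symm
    refine Finset.sum_eq_zero fun i _ => ?_
    by_contra hne
    have h1 := left_ne_zero_of_mul hne
    have h2 := right_ne_zero_of_mul hne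
    simp only [onWords, ne_eq, ite_eq_right_iff, Classical.not_imp] at h1 h2
    have h3 := h.toWord_mul h1.2 h2.2
    rw [h1.1.toWord_mk, h2.1.toWord_mk, List.take_append_drop] at h3
    exact hw (h3 ▸ isReduced_toWord)

theorem SupportedBy.onWords_star [Finite X] (ha : SupportedBy a I) (hn : ¬ I.nullable)
    (h : Compatible I.last I.first) :
    onWords (FGSeries.star a) =
      wordSingle [] 1 + wordMul (onWords a) (onWords (FGSeries.star a)) := by
  have h1 : MulReduced a (FGSeries.star a) := ha.mulReduced (ha.star hn h) h
  rw [← h1.onWords_cauchyMul]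
  funext w
  rw [Pi.add_apply, onWords, onWords]
  split_ifs with hw
  · rw [star_eq (ha.starDefined hn h), pow_zero, wordSingle]
    have : mk w = 1 ↔ w = [] := by rw [← toWord_eq_nil_iff, hw.toWord_mk]
    simp only [this]
  · have : w ≠ [] := fun h0 => hw (h0 ▸ IsReduced.nil)
    simp [wordSingle, this]

end FGSeries

open FGSeries FreeGroup

section Realizable

variable {K X : Type*} [Field K] {F L : Set (X × Bool)} {n : Prop}
  {f g : List (X × Bool) → K}

/-- The function `f` on words is the series of an expression that satisfies the syntactic criterion,
with first letters in `F` and last letters in `L`, and with a constant term only if `n` holds. -/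
def Realizable (F L : Set (X × Bool)) (n : Prop) (f : List (X × Bool) → K) : Prop :=
  ∃ e : RatExpr K X, e.info.ok ∧ e.info.first ⊆ F ∧ e.info.last ⊆ L ∧ (e.info.nullable → n) ∧
    onWords e.series = f

/-- The letters that may follow `y` in a reduced word. -/
def lettersAfter {X : Type*} (y : X × Bool) : Set (X × Bool) := {z | y.1 = z.1 → y.2 = z.2}

theorem compatible_lettersAfter {X : Type*} (y : X × Bool) : Compatible {y} (lettersAfter y) := by
  rintro _ rfl z hz
  exact hz

namespace Realizable

theorem add (hf : Realizable F L n f) (hg : Realizable F L n g) : Realizable F L n (f + g) := by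
  obtain ⟨e, h1, h2, h3, h4, rfl⟩ := hf
  obtain ⟨e', h1', h2', h3', h4', rfl⟩ := hg
  refine ⟨.add e e', ⟨h1, h1'⟩, Set.union_subset h2 h2', Set.union_subset h3 h3', ?_, ?_⟩
  · rintro (h | h)
    exacts [h4 h, h4' h]
  · funext w
    simp only [onWords, RatExpr.series, Pi.add_apply]
    split_ifs <;> simp

variable [DecidableEq X]

theorem single {w : List (X × Bool)} (hw : IsReduced w) (c : K)
    (h : c ≠ 0 → (∀ x ∈ w.head?, x ∈ F) ∧ (∀ x ∈ w.getLast?, x ∈ L) ∧ (w = [] → n)) :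
    Realizable F L n (wordSingle w c) := by
  refine ⟨.monomial c w, hw, fun x hx => (h hx.1).1 x hx.2, fun x hx => (h hx.1).2.1 x hx.2,
    fun hx => (h hx.1).2.2 (List.head?_eq_none_iff.1 hx.2), ?_⟩
  funext v
  simp only [onWords, RatExpr.series, wordSingle]
  by_cases hv : IsReduced v
  · have : mk v = mk w ↔ v = w := by rw [← toWord_inj, hv.toWord_mk, hw.toWord_mk]
    rw [if_pos hv]
    by_cases hvw : v = w <;> simp [hvw, this]
  · have hvw : v ≠ w := fun h0 => hv (h0 ▸ hw)
    simp [hv, hvw]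

theorem zero : Realizable F L n (0 : List (X × Bool) → K) := by
  have h := single (F := F) (L := L) (n := n) IsReduced.nil (0 : K) (fun h => absurd rfl h)
  convert h using 1
  funext w
  simp [wordSingle]

theorem sum {ι : Type*} (s : Finset ι) {f : ι → List (X × Bool) → K}
    (hf : ∀ i ∈ s, Realizable F L n (f i)) : Realizable F L n (∑ i ∈ s, f i) := by
  classical
  induction s using Finset.induction_on with
  | empty => exact zero
  | insert i s hi ih =>
    rw [Finset.sum_insert hi]
    exact (hf i (by simp)).add (ih fun j hj => hf j (by simp [hj]))

variable [Finite X]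

theorem mul {F₁ F₂ L₁ L₂ : Set (X × Bool)} {n₁ n₂ : Prop} (hf : Realizable F₁ L₁ n₁ f)
    (hg : Realizable F₂ L₂ n₂ g) (h : Compatible L₁ F₂) (hF₁ : F₁ ⊆ F) (hF₂ : n₁ → F₂ ⊆ F)
    (hL₂ : L₂ ⊆ L) (hL₁ : n₂ → L₁ ⊆ L) (hn : n₁ → n₂ → n) : Realizable F L n (wordMul f g) := by
  obtain ⟨e, h1, h2, h3, h4, rfl⟩ := hf
  obtain ⟨e', h1', h2', h3', h4', rfl⟩ := hg
  have hc : Compatible e.info.last e'.info.first := fun x hx y hy => h x (h3 hx) y (h2' hy)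
  refine ⟨.mul e e', ⟨h1, h1', hc⟩, ?_, ?_, fun h => hn (h4 h.1) (h4' h.2), ?_⟩
  · rintro x (hx | hx)
    exacts [hF₁ (h2 hx), hF₂ (h4 hx.1) (h2' hx.2)]
  · rintro x (hx | hx)
    exacts [hL₂ (h3' hx), hL₁ (h4' hx.1) (h3 hx.2)]
  · exact ((RatExpr.of_info_ok h1).2.2.mulReduced
      (RatExpr.of_info_ok h1').2.2 hc).onWords_cauchyMul

theorem star (hf : Realizable F L False f) (h : Compatible L F) :
    ∃ s, Realizable F L True s ∧ s = wordSingle [] 1 + wordMul f s := by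
  obtain ⟨e, h1, h2, h3, h4, rfl⟩ := hf
  have hc : Compatible e.info.last e.info.first := fun x hx y hy => h x (h3 hx) y (h2 hy)
  exact ⟨_, ⟨.star e, ⟨h1, h4, hc⟩, h2, h3, fun _ => trivial, rfl⟩,
    (RatExpr.of_info_ok h1).2.2.onWords_star h4 hc⟩

theorem apply_nil (hf : Realizable F L False f) : f [] = 0 := by
  obtain ⟨e, h1, h2, h3, h4, rfl⟩ := hf
  rw [onWords, if_pos IsReduced.nil]
  by_contra hne
  exact h4 (((RatExpr.of_info_ok h1).2.2 _ hne).1 rfl)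

/-- The solutions of a linear system whose states `p` carry letters `y p` are realizable, if the
coefficient from `p` to `q` consists of words that may follow `y p` and end with `y q`. Unknowns are
eliminated one by one with Arden's lemma; the condition on the coefficients is preserved, so that
no product or star in the resulting expressions simplifies. -/
theorem of_system {m : ℕ} (y : Fin m → X × Bool) (E : Fin m → Fin m → List (X × Bool) → K)
    (C g : Fin m → List (X × Bool) → K)
    (hE : ∀ p q, Realizable (lettersAfter (y p)) {y q} False (E p q))
    (hC : ∀ p, Realizable (lettersAfter (y p)) Set.univ True (C p))
    (hg : ∀ p, g p = C p + ∑ q, wordMul (E p q) (g q)) (p : Fin m) :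
    Realizable (lettersAfter (y p)) Set.univ True (g p) := by
  induction m with
  | zero => exact p.elim0
  | succ m ih =>
    obtain ⟨s, hs, hs'⟩ := (hE 0 0).star (compatible_lettersAfter _)
    have h0 : g 0 = wordMul s (C 0 + ∑ r : Fin m, wordMul (E 0 r.succ) (g r.succ)) := by
      refine arden (hE 0 0).apply_nil hs' ?_
      conv_lhs => rw [hg 0, Fin.sum_univ_succ]
      abel
    have hrest : ∀ r : Fin m, Realizable (lettersAfter (y r.succ)) Set.univ True (g r.succ) := by
      refine ih (fun r => y r.succ)
        (fun p q => E p.succ q.succ + wordMul (E p.succ 0) (wordMul s (E 0 q.succ)))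
        (fun p => C p.succ + wordMul (E p.succ 0) (wordMul s (C 0))) (fun r => g r.succ)
        (fun p q => ?_) (fun p => ?_) fun p => ?_
      · refine (hE _ _).add ((hE _ _).mul (hs.mul (F := lettersAfter (y 0)) (L := {y q.succ})
          (n := False) (hE 0 q.succ) (compatible_lettersAfter _) subset_rfl (fun _ => subset_rfl)
          subset_rfl (fun h => h.elim) fun _ h => h) (compatible_lettersAfter _) subset_rfl
          (fun h => h.elim) subset_rfl (fun h => h.elim) fun h _ => h)
      · refine (hC _).add ((hE _ _).mul (hs.mul (F := lettersAfter (y 0)) (L := Set.univ)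
          (n := True) (hC 0) (compatible_lettersAfter _) subset_rfl (fun _ => subset_rfl)
          subset_rfl (fun _ => Set.subset_univ _) fun _ _ => trivial) (compatible_lettersAfter _)
          subset_rfl (fun h => h.elim) subset_rfl (fun _ => Set.subset_univ _) fun h _ => h.elim)
      · conv_lhs => rw [hg p.succ, Fin.sum_univ_succ, h0]
        simp only [wordMul_add, wordMul_sum, add_wordMul, wordMul_assoc, Finset.sum_add_distrib]
        abel
    refine Fin.cases ?_ hrest p
    rw [h0]
    refine hs.mul (F₂ := lettersAfter (y 0)) (L₂ := Set.univ) (n₂ := True)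
      ((hC 0).add (sum _ fun r _ => ?_)) (compatible_lettersAfter _) subset_rfl
      (fun _ => subset_rfl) subset_rfl (fun _ => Set.subset_univ _) fun _ _ => trivial
    exact (hE _ _).mul (hrest r) (compatible_lettersAfter _) subset_rfl (fun h => h.elim)
      subset_rfl (fun _ => Set.subset_univ _) fun h _ => h.elim

end Realizable

end Realizable

section Kleene

variable {K X : Type*} [Field K] [DecidableEq X] {a : FGSeries K X} {d : ℕ}

theorem isReduced_cons_cons {X : Type*} {y z : X × Bool} {w : List (X × Bool)} :
    IsReduced (y :: z :: w) ↔ z ∈ lettersAfter y ∧ IsReduced (z :: w) :=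
  List.isChain_cons_cons

theorem notMem_cone_of_mem_lettersAfter {y z : X × Bool} {s : FreeGroup X} (hs : s ∉ cone y)
    (hz : z ∈ lettersAfter y) : (mk [y])⁻¹ * s ∉ cone z := by
  have h := inv_mk_mul_mem_cone hs
  intro h'
  rw [cone, Set.mem_ofPred_eq] at h h'
  rw [h, Option.some.injEq] at h'
  subst h'
  simpa using hz rfl

/-- Kleene's theorem: a series of bounded rank has an expression that satisfies the syntactic
criterion. The states of the automaton are the rows `p` that span the kernels, together with the
letter `y` of the edge; the state `(y, p)` accepts the words `w` with the coefficient of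
`p⁻¹ y w`. -/
theorem FGSeries.ConeRankLE.exists_expr [Finite X] (ha : ConeRankLE a d) :
    ∃ e : RatExpr K X, e.info.ok ∧ e.series = a := by
  classical
  have := Fintype.ofFinite X
  have hrows : ∀ y : X × Bool, ∃ (r : ℕ) (p : Fin r → FreeGroup X) (φ : FreeGroup X → Fin r → K),
      (∀ k, p k ∉ cone y) ∧
      ∀ s ∉ cone y, ∀ t ∈ cone y, a (s⁻¹ * t) = ∑ k, φ s k * a ((p k)⁻¹ * t) := by
    intro y
    obtain ⟨r, -, p, φ, h⟩ := (ha y).rows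
    refine ⟨r, fun k => p k, fun s k => if hs : s ∈ (cone y)ᶜ then φ ⟨s, hs⟩ k else 0,
      fun k => (p k).2, fun s hs t ht => ?_⟩
    have hs' : s ∈ (cone y)ᶜ := hs
    simp only [dif_pos hs']
    exact h ⟨s, hs⟩ ⟨t, ht⟩
  choose r p φ hp hφ using hrows
  let Q := Σ y : X × Bool, Fin (r y)
  let G : Q → List (X × Bool) → K := fun q w =>
    if IsReduced (q.1 :: w) then a ((p q.1 q.2)⁻¹ * mk (q.1 :: w)) else 0
  let coeff : Q → Q → K := fun q q' =>
    if q'.1 ∈ lettersAfter q.1 then φ q'.1 ((mk [q.1])⁻¹ * p q.1 q.2) q'.2 else 0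
  -- Reading the first letter `z` of a word selects the states that carry `z`.
  have hsum : ∀ (c : Q → K) (z : X × Bool) (w : List (X × Bool)),
      (∑ q, wordMul (wordSingle [q.1] (c q)) (G q)) (z :: w) = ∑ k, c ⟨z, k⟩ * G ⟨z, k⟩ w := by
    intro c z w
    rw [Finset.sum_apply, Fintype.sum_sigma, Finset.sum_eq_single z]
    · simp [wordSingle_letter_wordMul_cons]
    · intro z' _ hz
      exact Finset.sum_eq_zero fun k _ => by
        rw [wordSingle_letter_wordMul_cons, if_neg (Ne.symm hz)]
    · simp
  have hsum_nil : ∀ c : Q → K, (∑ q, wordMul (wordSingle [q.1] (c q)) (G q)) [] = 0 := by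
    intro c
    simp [wordMul, wordSingle]
  have hG : ∀ q, G q = wordSingle [] (a ((p q.1 q.2)⁻¹ * mk [q.1])) +
      ∑ q', wordMul (wordSingle [q'.1] (coeff q q')) (G q') := by
    rintro ⟨y, k⟩
    funext w
    rw [Pi.add_apply]
    cases w with
    | nil => rw [hsum_nil]; simp [G, wordSingle]
    | cons z w =>
      rw [hsum]
      simp only [G, coeff, wordSingle, reduceCtorEq, if_false, zero_add,
        isReduced_cons_cons (y := y)]
      by_cases hz : z ∈ lettersAfter y <;> by_cases hw : IsReduced (z :: w)
      · simp only [hz, hw, and_self, if_true]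
        rw [← hφ z _ (notMem_cone_of_mem_lettersAfter (hp y k) hz) _ (mk_cons_mem_cone hw)]
        congr 1
        rw [mul_inv_rev, inv_inv, mul_assoc, mul_mk]
        rfl
      · simp [hw]
      · simp [hz]
      · simp [hw]
  have hreal : ∀ q, Realizable (lettersAfter q.1) Set.univ True (G q) := by
    let ε := (Fintype.equivFin Q).symm
    have h := Realizable.of_system (fun i => (ε i).1)
      (fun i j => wordSingle [(ε j).1] (coeff (ε i) (ε j)))
      (fun i => wordSingle [] (a ((p (ε i).1 (ε i).2)⁻¹ * mk [(ε i).1]))) (fun i => G (ε i))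
      (fun i j => Realizable.single IsReduced.singleton _ fun hc => by
        simp only [coeff, ne_eq, ite_eq_right_iff, Classical.not_imp] at hc
        simpa using hc.1)
      (fun i => Realizable.single IsReduced.nil _ fun _ => by simp)
      (fun i => by
        rw [hG]
        congr 1
        exact (Equiv.sum_comp ε fun q' =>
          wordMul (wordSingle [q'.1] (coeff (ε i) q')) (G q')).symm)
    intro q
    have := h (ε.symm q)
    simpa using this
  have hfinal : onWords a = wordSingle [] (a 1) +
      ∑ q : Q, wordMul (wordSingle [q.1] (φ q.1 1 q.2)) (G q) := by
    funext w
    rw [Pi.add_apply]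
    cases w with
    | nil => rw [hsum_nil]; simp [onWords, wordSingle, one_eq_mk]
    | cons z w =>
      rw [hsum fun q => φ q.1 1 q.2]
      simp only [onWords, G, wordSingle, reduceCtorEq, if_false, zero_add]
      by_cases hw : IsReduced (z :: w)
      · simp only [hw, if_true]
        rw [← hφ z 1 (one_notMem_cone z) _ (mk_cons_mem_cone hw), inv_one, one_mul]
      · simp [hw]
  obtain ⟨e, h1, -, -, -, h2⟩ : Realizable Set.univ Set.univ True (onWords a) := by
    rw [hfinal]
    refine (Realizable.single IsReduced.nil _ fun _ => by simp).add (Realizable.sum _ fun q _ => ?_)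
    refine (Realizable.single (F := {q.1}) (L := {q.1}) (n := False) IsReduced.singleton _
      fun _ => by simp).mul (hreal q) (compatible_lettersAfter _) (Set.subset_univ _)
      (fun _ => Set.subset_univ _) subset_rfl (fun _ => Set.subset_univ _) fun _ _ => trivial
  exact ⟨e, h1, onWords_injective h2⟩

end Kleene

namespace RatExpr

variable {K X : Type*} [Field K]

/-- The total length of a written expression, which bounds the rank of its series. -/
def codeSize (l : List (Symbol K X)) : ℕ :=
  (l.map (Sum.elim (fun p => p.2.length + 1) fun _ => 0)).sum

theorem WellDefined.coneRankLE [DecidableEq X] {e : RatExpr K X} (h : e.WellDefined) :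
    ConeRankLE e.series (codeSize e.code) := by
  induction e with
  | monomial c w =>
    have hs : (monomial c w).series = fun ω => if ω = mk w then c else 0 := by
      funext ω
      by_cases h0 : ω = mk w <;> simp [series, h0]
    rw [hs]
    refine (ConeRankLE.monomial c (mk w)).mono ?_
    simpa [codeSize, code] using norm_mk_le (L₁ := w)
  | add e₁ e₂ ih₁ ih₂ =>
    exact ((ih₁ h.1).add (ih₂ h.2)).mono (by simp [codeSize, code])
  | mul e₁ e₂ ih₁ ih₂ =>
    exact ((ih₁ h.1).cauchyMul (ih₂ h.2.1) h.2.2).mono (by simp [codeSize, code])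
  | star e ih =>
    exact ((ih h.1).star h.2).mono (by simp [codeSize, code])

theorem WellDefined.exists_equivalent [DecidableEq X] [Finite X] {e : RatExpr K X}
    (h : e.WellDefined) : ∃ e' : RatExpr K X, e'.info.ok ∧ e'.series = e.series :=
  h.coneRankLE.exists_expr

end RatExpr

/-! ### Folding partial recursive functions over lists -/

section PartialFold

variable {α β σ : Type*}

/-- Folding a partial function over a list. -/
def List.foldPart (g : β → σ → Part σ) (l : List β) (s : σ) : Part σ :=
  l.foldl (fun t b => t.bind (g b)) (Part.some s)

theorem List.foldPart_eq_some {g : β → σ → Part σ} {G : β → σ → σ} {l : List β}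
    (h : ∀ b ∈ l, ∀ s, g b s = Part.some (G b s)) (s : σ) :
    l.foldPart g s = Part.some (l.foldl (fun s b => G b s) s) := by
  unfold List.foldPart
  induction l generalizing s with
  | nil => rfl
  | cons b l ih =>
    rw [List.foldl_cons, Part.bind_some, h b (by simp), ih (fun b hb => h b (by simp [hb]))]
    rfl

variable [Primcodable α] [Primcodable β] [Primcodable σ]

theorem Partrec.list_foldPart {l : α → List β} {s : α → σ} {g : α → β × σ →. σ}
    (hl : Computable l) (hs : Computable s) (hg : Partrec₂ g) :
    Partrec fun a => (l a).foldPart (fun b s => g a (b, s)) (s a) := by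
  have h1 : Partrec₂ fun (a : α) (p : ℕ × σ) =>
      (Option.casesOn ((l a)[p.1]?) (Part.some p.2) fun b => g a (b, p.2) : Part σ) := by
    refine Partrec.optionCasesOn_right
      (Computable.list_getElem?.comp (hl.comp .fst) (Computable.fst.comp .snd))
      (Computable.snd.comp .snd) ?_
    exact hg.comp (Computable.fst.comp .fst)
      (Computable.snd.pair (Computable.snd.comp (Computable.snd.comp .fst)))
  refine (Partrec.nat_rec (Computable.list_length.comp hl) hs.partrec h1).of_eq fun a => ?_
  have key : ∀ n ≤ (l a).length, (Nat.rec (Part.some (s a)) (fun y IH => IH.bind fun i =>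
      (Option.casesOn ((l a)[y]?) (Part.some i) fun b => g a (b, i) : Part σ)) n : Part σ) =
      ((l a).take n).foldPart (fun b s => g a (b, s)) (s a) := by
    intro n hn
    induction n with
    | zero => simp [List.foldPart]
    | succ n ih =>
      have h2 : n < (l a).length := hn
      have h3 : ((l a).take (n + 1)).foldPart (fun b s => g a (b, s)) (s a) =
          (((l a).take n).foldPart (fun b s => g a (b, s)) (s a)).bind
            fun i => g a ((l a)[n], i) := by
        rw [List.foldPart, List.take_succ_eq_append_getElem h2, List.foldl_append]
        rfl
      rw [h3, ← ih h2.le]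
      simp only [List.getElem?_eq_getElem h2]
  simpa using key _ le_rfl

end PartialFold

/-! ### Words as data -/

section Words

open FreeGroup

variable {X : Type*} [Finite X]

variable (X) in
/-- The letters `x` and `x⁻¹`, in some order. -/
noncomputable def letterList : List (X × Bool) :=
  (Set.finite_univ (α := X × Bool)).toFinset.toList

variable (X) in
/-- The words of length at most `n`. -/
noncomputable def shortWords : ℕ → List (List (X × Bool))
  | 0 => [[]]
  | n + 1 => [] :: (letterList X).flatMap fun x => (shortWords n).map (x :: ·)

theorem mem_letterList (x : X × Bool) : x ∈ letterList X := by
  simp [letterList]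

theorem mem_shortWords {n : ℕ} {w : List (X × Bool)} : w ∈ shortWords X n ↔ w.length ≤ n := by
  induction n generalizing w with
  | zero => simp [shortWords]
  | succ n ih => cases w <;> simp [shortWords, ih, mem_letterList]

theorem nodup_shortWords (n : ℕ) : (shortWords X n).Nodup := by
  induction n with
  | zero => simp [shortWords]
  | succ n ih =>
    rw [shortWords, List.nodup_cons, List.nodup_flatMap]
    refine ⟨by simp, fun x _ => ih.map (List.cons_injective), ?_⟩
    refine (Finset.nodup_toList _).imp fun {x y} hxy => ?_
    rw [Function.onFun, List.disjoint_left]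
    rintro w hw hw'
    obtain ⟨u, -, rfl⟩ := List.mem_map.1 hw
    obtain ⟨v, -, h⟩ := List.mem_map.1 hw'
    exact hxy (List.cons.inj h).1.symm

open Classical in
variable (X) in
/-- The reduced words of length at most `n`. -/
noncomputable def ballList (n : ℕ) : List (List (X × Bool)) :=
  (shortWords X n).filter fun w => IsReduced w

theorem mem_ballList {n : ℕ} {w : List (X × Bool)} :
    w ∈ ballList X n ↔ w.length ≤ n ∧ IsReduced w := by
  simp [ballList, mem_shortWords]

theorem nodup_ballList (n : ℕ) : (ballList X n).Nodup := (nodup_shortWords n).filter _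

section Primrec

variable [Primcodable X]

theorem primrec_flip : Primrec fun x : X × Bool => (x.1, !x.2) := Primrec.dom_finite _

theorem primrec_invRev : Primrec (invRev : List (X × Bool) → _) :=
  Primrec.list_reverse.comp (Primrec.list_map .id (primrec_flip.comp .snd).to₂)

theorem primrec_shortWords : Primrec (shortWords X) := by
  have h1 : Primrec fun L : List (List (X × Bool)) =>
      [] :: (letterList X).flatMap fun x => L.map (x :: ·) := by
    refine Primrec.list_cons.comp (Primrec.const []) (Primrec.list_flatMap (Primrec.const _) ?_)
    exact (Primrec.list_map Primrec.fst
      (Primrec.list_cons.comp (Primrec.snd.comp Primrec.fst) Primrec.snd).to₂)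
  refine (Primrec.nat_rec₁ [[]] (h1.comp Primrec.snd).to₂).of_eq fun n => ?_
  induction n with
  | zero => rfl
  | succ n ih => simp only [shortWords, ← ih]

end Primrec

variable [DecidableEq X]

theorem toWord_mem_ballList {n : ℕ} {g : FreeGroup X} (h : g.norm ≤ n) : g.toWord ∈ ballList X n :=
  mem_ballList.2 ⟨h, isReduced_toWord⟩

/-- A Cauchy product as a sum over a ball that contains all relevant left factors. -/
theorem FGSeries.sum_ballList {K : Type*} [Field K] {a b : FGSeries K X} {n : ℕ}
    {w : List (X × Bool)} (h : ∀ α : FreeGroup X, a α * b (α⁻¹ * mk w) ≠ 0 → α.norm ≤ n) :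
    ((ballList X n).map fun u => a (mk u) * b (mk (invRev u ++ w))).sum =
      cauchyMul a b (mk w) := by
  classical
  have h1 := cauchyMul_eq_sum (a := a) (b := b) 1 (mk w) ((ballList X n).toFinset.image mk)
    (fun v hv => Finset.mem_image.2 ⟨v.toWord, by
      rw [inv_one, one_mul] at hv
      simpa using toWord_mem_ballList (h v hv), mk_toWord⟩)
  rw [inv_one, one_mul] at h1
  rw [h1, Finset.sum_image, List.sum_toFinset _ (nodup_ballList n)]
  · simp only [one_mul, inv_mk, mul_mk]
  · intro u hu v hv huv
    have hu' := (mem_ballList.1 (List.mem_toFinset.1 hu)).2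
    have hv' := (mem_ballList.1 (List.mem_toFinset.1 hv)).2
    rw [← hu'.toWord_mk, ← hv'.toWord_mk, huv]

variable [Primcodable X]

theorem primrec_reduce : Primrec (reduce : List (X × Bool) → _) := by
  have h1 : Primrec₂ fun (_ : List (X × Bool)) (p : (X × Bool) × List (X × Bool)) =>
      if p.2.head? = some (p.1.1, !p.1.2) then p.2.tail else p.1 :: p.2 := by
    refine Primrec.ite (Primrec.eq.comp (Primrec.list_head?.comp (Primrec.snd.comp .snd))
      (Primrec.option_some.comp (primrec_flip.comp (Primrec.fst.comp .snd)))) ?_ ?_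
    · exact Primrec.list_tail.comp (Primrec.snd.comp .snd)
    · exact Primrec.list_cons.comp (Primrec.fst.comp .snd) (Primrec.snd.comp .snd)
  refine (Primrec.list_foldr Primrec.id (Primrec.const []) h1).of_eq fun w => ?_
  induction w with
  | nil => rfl
  | cons x w ih =>
    simp only [id] at ih
    rw [id, List.foldr_cons, ih, reduce.cons]
    cases reduce w with
    | nil => simp
    | cons y v =>
      obtain ⟨x1, x2⟩ := x
      obtain ⟨y1, y2⟩ := y
      simp only [List.head?_cons, Option.some.injEq, Prod.mk.injEq, List.tail_cons]
      refine if_congr ?_ rfl rfl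
      cases x2 <;> cases y2 <;> simp [eq_comm]

theorem primrecPred_isReduced : PrimrecPred (IsReduced : List (X × Bool) → Prop) :=
  (Primrec.eq.comp primrec_reduce .id).of_eq fun _ => isReduced_iff_reduce_eq.symm

theorem primrec_ballList : Primrec (ballList X) := by
  classical
  exact (Primrec.listFilter primrecPred_isReduced).comp primrec_shortWords

end Words

/-! ### Programs that compute the coefficients of a series -/

section SeriesCode

open FreeGroup
open Nat.Partrec (Code)
open Encodable (encode decode)

variable {K X : Type*}

section PartialSums

/-- A sum of partial values over a list. -/
def sumPart [Field K] {β : Type*} (l : List β) (f : β → Part K) : Part K :=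
  l.foldPart (fun b s => (f b).map fun x => s + x) 0

theorem sumPart_eq_some [Field K] {β : Type*} {l : List β} {f : β → Part K} {φ : β → K}
    (h : ∀ b ∈ l, f b = Part.some (φ b)) : sumPart l f = Part.some (l.map φ).sum := by
  rw [sumPart, List.foldPart_eq_some (G := fun b s => s + φ b) fun b hb s => by simp [h b hb],
    List.sum_eq_foldl, List.foldl_map]

/-- Whether two partial functions agree on a list. -/
def agreePart [DecidableEq K] {β : Type*} (l : List β) (f g : β → Part K) : Part Bool :=
  l.foldPart (fun b s => (f b).bind fun x => (g b).map fun y => s && decide (x = y)) true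

theorem agreePart_eq_some [DecidableEq K] {β : Type*} {l : List β} {f g : β → Part K}
    {φ ψ : β → K} (hf : ∀ b ∈ l, f b = Part.some (φ b)) (hg : ∀ b ∈ l, g b = Part.some (ψ b)) :
    agreePart l f g = Part.some (decide (∀ b ∈ l, φ b = ψ b)) := by
  rw [agreePart, List.foldPart_eq_some (G := fun b s => s && decide (φ b = ψ b))
    fun b hb s => by simp [hf b hb, hg b hb]]
  have key : ∀ (l : List β) (s : Bool), l.foldl (fun s b => s && decide (φ b = ψ b)) s =
      (s && decide (∀ b ∈ l, φ b = ψ b)) := by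
    intro l
    induction l with
    | nil => simp
    | cons b l ih =>
      intro s
      rw [List.foldl_cons, ih]
      simp [Bool.and_assoc]
  simp [key]

end PartialSums

section Codes

variable [Primcodable K] [Primcodable X]

/-- The coefficient at the word `w` that is computed by the program `c`. -/
def evalCode (K : Type*) [Primcodable K] (c : Code) (w : List (X × Bool)) : Part K :=
  (c.eval (encode w)).bind fun n => (decode n : Option K)

theorem partrec_evalCode : Partrec₂ (evalCode K : Code → List (X × Bool) → Part K) :=
  (Code.eval_part.comp Computable.fst (Computable.encode.comp Computable.snd)).bind
    (Computable.ofOption (Computable.decode.comp Computable.snd)).to₂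

/-- A partial recursive function of a parameter and a word yields a primitive recursive family of
programs, by the `S-m-n` theorem. -/
theorem exists_primrec_code {P : Type*} [Primcodable P] {f : P × List (X × Bool) →. K}
    (hf : Partrec f) :
    ∃ g : P → Code, Primrec g ∧ ∀ p w, evalCode K (g p) w = f (p, w) := by
  obtain ⟨c, hc⟩ := Code.exists_code.1 hf
  refine ⟨fun p => Code.curry c (encode p),
    Code.primrec₂_curry.comp (Primrec.const c) Primrec.encode, fun p w => ?_⟩
  have h : c.eval (Nat.pair (encode p) (encode w)) = (f (p, w)).map encode := by
    rw [hc]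
    have h1 : (decode (Nat.pair (encode p) (encode w)) : Option (P × List (X × Bool))) =
        some (p, w) := Encodable.encodek (p, w)
    change ((decode (Nat.pair (encode p) (encode w)) : Option (P × List (X × Bool))) :
      Part (P × List (X × Bool))).bind (fun a => (f a).map encode) = _
    rw [h1]
    exact Part.bind_some _ _
  rw [evalCode, Code.eval_curry, h, ← Part.bind_some_eq_map, Part.bind_assoc]
  simp

variable {α β : Type*} [Primcodable α] [Primcodable β]

theorem Partrec.sumPart [Field K] (hK : IsComputableField K) {l : α → List β} {f : α → β →. K}
    (hl : Computable l) (hf : Partrec₂ f) : Partrec fun a => sumPart (l a) (f a) :=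
  Partrec.list_foldPart hl (Computable.const 0) (g := fun a p => (f a p.1).map fun x => p.2 + x)
    ((hf.comp Computable.fst (Computable.fst.comp Computable.snd)).map
      (hK.computable_add.comp (Computable.snd.comp (Computable.snd.comp Computable.fst))
        Computable.snd).to₂)

theorem Partrec.agreePart [DecidableEq K] {l : α → List β} {f g : α → β →. K}
    (hl : Computable l) (hf : Partrec₂ f) (hg : Partrec₂ g) :
    Partrec fun a => agreePart (l a) (f a) (g a) := by
  have e1 : Partrec fun q : α × β × Bool => f q.1 q.2.1 :=
    hf.comp Computable.fst (Computable.fst.comp Computable.snd)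
  have e2 : Partrec fun q : (α × β × Bool) × K => g q.1.1 q.1.2.1 :=
    hg.comp (Computable.fst.comp Computable.fst)
      (Computable.fst.comp (Computable.snd.comp Computable.fst))
  have e3 : Primrec₂ fun (q : (α × β × Bool) × K) (y : K) => q.1.2.2 && decide (q.2 = y) :=
    Primrec.and.comp (Primrec.snd.comp (Primrec.snd.comp (Primrec.fst.comp Primrec.fst)))
      ((Primrec.eq (α := K)).decide.comp (Primrec.snd.comp Primrec.fst) Primrec.snd)
  exact Partrec.list_foldPart hl (Computable.const true)
    (g := fun a p => (f a p.1).bind fun x => (g a p.1).map fun y => p.2 && decide (x = y))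
    (e1.bind (e2.map e3.to_comp).to₂).to₂

end Codes

variable [Field K] [Primcodable K] [Primcodable X]

/-- The program `c` computes the coefficients of the series `a`. -/
def Computes (c : Code) (a : FGSeries K X) : Prop :=
  ∀ w : List (X × Bool), evalCode K c w = Part.some (a (mk w))

theorem exists_code_add (hK : IsComputableField K) :
    ∃ f : Code × Code → Code, Primrec f ∧ ∀ (c₁ c₂ : Code) (a b : FGSeries K X),
      Computes c₁ a → Computes c₂ b → Computes (f (c₁, c₂)) fun ω => a ω + b ω := by
  have e1 : Partrec fun p : (Code × Code) × List (X × Bool) => evalCode K p.1.1 p.2 :=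
    partrec_evalCode.comp (Computable.fst.comp Computable.fst) Computable.snd
  have e2 : Partrec fun q : ((Code × Code) × List (X × Bool)) × K =>
      evalCode K q.1.1.2 q.1.2 :=
    partrec_evalCode.comp (Computable.snd.comp (Computable.fst.comp Computable.fst))
      (Computable.snd.comp Computable.fst)
  have e3 : Computable₂ fun (q : ((Code × Code) × List (X × Bool)) × K) (y : K) => q.2 + y :=
    hK.computable_add.comp (Computable.snd.comp Computable.fst) Computable.snd
  have h1 : Partrec fun p : (Code × Code) × List (X × Bool) =>
      (evalCode K p.1.1 p.2).bind fun x => (evalCode K p.1.2 p.2).map fun y => x + y :=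
    e1.bind (e2.map e3).to₂
  obtain ⟨f, hf, h⟩ := exists_primrec_code h1
  refine ⟨f, hf, fun c₁ c₂ a b ha hb w => ?_⟩
  rw [h]
  simp [ha w, hb w]

variable [DecidableEq X] [Finite X]

theorem exists_code_monomial :
    ∃ m : K × List (X × Bool) → Code, Primrec m ∧
      ∀ c w, Computes (m (c, w)) (RatExpr.monomial c w).series := by
  classical
  have h1 : Primrec fun p : (K × List (X × Bool)) × List (X × Bool) =>
      if reduce p.2 = reduce p.1.2 then p.1.1 else 0 :=
    Primrec.ite (Primrec.eq.comp (primrec_reduce.comp .snd)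
      (primrec_reduce.comp (Primrec.snd.comp .fst))) (Primrec.fst.comp .fst) (Primrec.const 0)
  obtain ⟨m, hm, h⟩ := exists_primrec_code (K := K) h1.to_comp.partrec
  refine ⟨m, hm, fun c w v => ?_⟩
  rw [h]
  have h2 : reduce v = reduce w ↔ mk v = mk w := ⟨reduce.exact, reduce.sound⟩
  by_cases h3 : mk v = mk w <;> simp [RatExpr.series, h2, h3]

/-- A program for a Cauchy product, given a bound `B` for the excess length of the left factors. -/
theorem exists_code_mul (hK : IsComputableField K) :
    ∃ f : ℕ × Code × Code → Code, Primrec f ∧ ∀ (B : ℕ) (c₁ c₂ : Code) (a b : FGSeries K X),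
      Computes c₁ a → Computes c₂ b →
      (∀ α ω : FreeGroup X, a α * b (α⁻¹ * ω) ≠ 0 → α.norm ≤ ω.norm + B) →
      Computes (f (B, c₁, c₂)) (FGSeries.cauchyMul a b) := by
  have e0 : Primrec fun p : (ℕ × Code × Code) × List (X × Bool) =>
      ballList X (p.2.length + p.1.1) :=
    primrec_ballList.comp (Primrec.nat_add.comp (Primrec.list_length.comp Primrec.snd)
      (Primrec.fst.comp Primrec.fst))
  have e1 : Partrec fun q : ((ℕ × Code × Code) × List (X × Bool)) × List (X × Bool) =>
      evalCode K q.1.1.2.1 q.2 :=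
    partrec_evalCode.comp (Primrec.fst.comp (Primrec.snd.comp
      (Primrec.fst.comp Primrec.fst))).to_comp Computable.snd
  have e2 : Partrec fun q : (((ℕ × Code × Code) × List (X × Bool)) × List (X × Bool)) × K =>
      evalCode K q.1.1.1.2.2 (invRev q.1.2 ++ q.1.1.2) :=
    partrec_evalCode.comp (Primrec.snd.comp (Primrec.snd.comp (Primrec.fst.comp
      (Primrec.fst.comp Primrec.fst)))).to_comp
      (Primrec.list_append.comp (primrec_invRev.comp (Primrec.snd.comp Primrec.fst))
        (Primrec.snd.comp (Primrec.fst.comp Primrec.fst))).to_comp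
  have e3 : Computable₂ fun (q : (((ℕ × Code × Code) × List (X × Bool)) × List (X × Bool)) × K)
      (y : K) => q.2 * y :=
    hK.computable_mul.comp (Computable.snd.comp Computable.fst) Computable.snd
  have h1 : Partrec fun p : (ℕ × Code × Code) × List (X × Bool) =>
      sumPart (ballList X (p.2.length + p.1.1)) fun u =>
        (evalCode K p.1.2.1 u).bind fun x =>
          (evalCode K p.1.2.2 (invRev u ++ p.2)).map fun y => x * y :=
    Partrec.sumPart hK e0.to_comp (e1.bind (e2.map e3).to₂).to₂
  obtain ⟨f, hf, h⟩ := exists_primrec_code h1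
  refine ⟨f, hf, fun B c₁ c₂ a b ha hb hB w => ?_⟩
  rw [h, sumPart_eq_some (φ := fun u => a (mk u) * b (mk (invRev u ++ w)))
    fun u _ => by simp [ha u, hb (invRev u ++ w)]]
  rw [FGSeries.sum_ballList]
  intro α hα
  have := hB α _ hα
  have := norm_mk_le (L₁ := w)
  simp only
  omega

/-- A program for a star. It looks for a power that vanishes on a sufficiently large ball, and sums
up the lower powers. -/
theorem exists_code_star (hK : IsComputableField K) :
    ∃ f : ℕ × Code → Code, Primrec f ∧ ∀ (d : ℕ) (c : Code) (a : FGSeries K X),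
      Computes c a → FGSeries.StarDefined a → FGSeries.ConeRankLE a d →
      Computes (f (Nat.card (X × Bool) * (d * d), c)) (FGSeries.star a) := by
  classical
  obtain ⟨m, hm, hm'⟩ := exists_code_monomial (K := K) (X := X)
  obtain ⟨g, hg, hg'⟩ := exists_code_mul (X := X) hK
  let powCode : ℕ × Code → ℕ → Code := fun p k =>
    Nat.rec (m (1, [])) (fun _ c => g (p.1, p.2, c)) k
  have hpow : Primrec₂ powCode := Primrec.nat_rec (Primrec.const (m (1, [])))
    (hg.comp ((Primrec.fst.comp .fst).pair ((Primrec.snd.comp .fst).pair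
      (Primrec.snd.comp .snd)))).to₂
  let check : (ℕ × Code) × List (X × Bool) → ℕ → Part Bool := fun p k =>
    agreePart (ballList X (p.2.length + p.1.1)) (evalCode K (powCode p.1 k)) fun _ =>
      Part.some 0
  have hcheck : Partrec₂ check := by
    refine Partrec.agreePart
      (l := fun q : ((ℕ × Code) × List (X × Bool)) × ℕ => ballList X (q.1.2.length + q.1.1.1))
      (f := fun q => evalCode K (powCode q.1.1 q.2)) (g := fun _ _ => Part.some 0) ?_ ?_ ?_
    · exact (primrec_ballList.comp (Primrec.nat_add.comp (Primrec.list_length.comp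
        (Primrec.snd.comp .fst)) (Primrec.fst.comp (Primrec.fst.comp .fst)))).to_comp
    · exact partrec_evalCode.comp (hpow.comp (Primrec.fst.comp (Primrec.fst.comp .fst))
        (Primrec.snd.comp .fst)).to_comp .snd
    · exact (Computable.const 0).partrec
  have h1 : Partrec fun p : (ℕ × Code) × List (X × Bool) =>
      (Nat.rfind (check p)).bind fun k =>
        sumPart (List.range k) fun j => evalCode K (powCode p.1 j) p.2 := by
    refine (Partrec.rfind hcheck).bind ?_
    refine (Partrec.sumPart hK
      (l := fun q : ((ℕ × Code) × List (X × Bool)) × ℕ => List.range q.2)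
      (f := fun q j => evalCode K (powCode q.1.1 j) q.1.2)
      (Primrec.list_range.comp .snd).to_comp ?_).to₂
    exact partrec_evalCode.comp (hpow.comp (Primrec.fst.comp (Primrec.fst.comp .fst))
      .snd).to_comp (Primrec.snd.comp (Primrec.fst.comp .fst)).to_comp
  obtain ⟨f, hf, h⟩ := exists_primrec_code h1
  refine ⟨f, hf, fun d c a hc ha hd w => ?_⟩
  set B := Nat.card (X × Bool) * (d * d) with hB
  have hcomp : ∀ k, Computes (powCode (B, c) k) (FGSeries.pow a k) := by
    intro k
    induction k with
    | zero =>
      have h2 : FGSeries.pow a 0 = (RatExpr.monomial (1 : K) ([] : List (X × Bool))).series := by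
        funext ω
        rw [FGSeries.pow_zero]
        by_cases h3 : ω = 1 <;> simp [RatExpr.series, ← one_eq_mk, h3]
      rw [h2]
      exact hm' 1 []
    | succ k ih =>
      rw [show FGSeries.pow a (k + 1) = FGSeries.cauchyMul a (FGSeries.pow a k) by
        rw [add_comm, FGSeries.pow_add ha, FGSeries.pow_one]]
      refine hg' B c _ a _ hc ih fun α ω hα => ?_
      refine hd.norm_le_of_pow_mul_pow_ne_zero ha (i := 1) ?_ (right_ne_zero_of_mul hα)
      rw [FGSeries.pow_one]
      exact left_ne_zero_of_mul hα
  let t : ℕ → Bool := fun k =>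
    decide (∀ u ∈ ballList X (w.length + B), FGSeries.pow a k (mk u) = 0)
  have ht : check ((B, c), w) = fun k => Part.some (t k) := by
    funext k
    exact agreePart_eq_some (fun u _ => hcomp k u) fun u _ => rfl
  obtain ⟨k, hk⟩ : ∃ k, t k := by
    choose n hn using FGSeries.exists_pow_eq_zero ha
    refine ⟨((ballList X (w.length + B)).toFinset.sup fun u => n (mk u)), ?_⟩
    refine decide_eq_true fun u hu => hn _ _ ?_
    exact Finset.le_sup (f := fun u => n (mk u)) (List.mem_toFinset.2 hu)
  obtain ⟨k, hk, -⟩ := Nat.rfind_min' hk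
  have hk' : t k = true := by simpa using Nat.rfind_spec hk
  rw [h]
  have h3 : Nat.rfind (check ((B, c), w)) = Part.some k := by
    rw [ht]
    exact Part.eq_some_iff.2 hk
  rw [h3, Part.bind_some, sumPart_eq_some (φ := fun j => FGSeries.pow a j (mk w))
    fun j _ => hcomp j w]
  congr 1
  rw [FGSeries.star_eq_sum_pow ha (mk w) k fun j hj => ?_]
  · rw [← List.sum_toFinset _ List.nodup_range]
    refine Finset.sum_congr ?_ fun _ _ => rfl
    ext j
    simp
  · refine hd.pow_eq_zero_of_short ha (n := k) (fun α hα => ?_) hj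
    have h4 := norm_mk_le (L₁ := w)
    have h5 := of_decide_eq_true hk' α.toWord (toWord_mem_ballList (by omega))
    rwa [mk_toWord] at h5

end SeriesCode

/-! ### Evaluating written expressions with a stack -/

namespace RatExpr

variable {K X σ : Type*}

/-- One step of the evaluation of a written expression in an algebra `σ`: a monomial is interpreted
by `m` and put on the stack, and an operation symbol `i` is applied by `f` to the entries on top of
the stack; the star takes the same entry as both arguments. -/
def runStep (m : K × List (X × Bool) → σ) (f : Fin 3 × σ × σ → σ) (s : List σ) :
    Symbol K X → Option (List σ)
  | Sum.inl p => some (m p :: s)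
  | Sum.inr i =>
    if i = 2 then s.head?.map fun x => f (i, x, x) :: s.tail
    else s.head?.bind fun x => s.tail.head?.map fun y => f (i, y, x) :: s.tail.tail

/-- The evaluation of a written expression in an algebra, starting with the stack `s`. -/
def run (m : K × List (X × Bool) → σ) (f : Fin 3 × σ × σ → σ) (l : List (Symbol K X))
    (s : List σ) : Option (List σ) :=
  l.foldl (fun t x => t.bind fun s => runStep m f s x) (some s)

/-- The value of an expression in an algebra. -/
def value (m : K × List (X × Bool) → σ) (f : Fin 3 × σ × σ → σ) : RatExpr K X → σ
  | monomial c w => m (c, w)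
  | add e₁ e₂ => f (0, e₁.value m f, e₂.value m f)
  | mul e₁ e₂ => f (1, e₁.value m f, e₂.value m f)
  | star e => f (2, e.value m f, e.value m f)

variable (m : K × List (X × Bool) → σ) (f : Fin 3 × σ × σ → σ)

theorem run_code_append (e : RatExpr K X) (l : List (Symbol K X)) (s : List σ) :
    run m f (e.code ++ l) s = run m f l (e.value m f :: s) := by
  induction e generalizing l s with
  | monomial c w => rfl
  | add e₁ e₂ h₁ h₂ =>
    rw [code, List.append_assoc, List.append_assoc, h₁, h₂]
    rfl
  | mul e₁ e₂ h₁ h₂ =>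
    rw [code, List.append_assoc, List.append_assoc, h₁, h₂]
    rfl
  | star e h =>
    rw [code, List.append_assoc, h]
    rfl

theorem run_code (e : RatExpr K X) : run m f e.code [] = some [e.value m f] := by
  simpa [run] using run_code_append m f e [] []

/-- The evaluation of a string succeeds only if the string consists of written expressions. -/
theorem exists_of_run {l : List (Symbol K X)} {s : List σ} (h : run m f l [] = some s) :
    ∃ es : List (RatExpr K X), s = es.map (value m f) ∧ l = (es.reverse.map code).flatten := by
  induction l using List.reverseRecOn generalizing s with
  | nil =>
    simp only [run, List.foldl_nil, Option.some.injEq] at h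
    exact ⟨[], by simp [← h], by simp⟩
  | append_singleton l x ih =>
    rw [run, List.foldl_append] at h
    obtain ⟨t, ht, h'⟩ := Option.bind_eq_some_iff.1 h
    obtain ⟨es, rfl, rfl⟩ := ih ht
    rcases x with ⟨c, w⟩ | i
    · simp only [runStep, Option.some.injEq] at h'
      exact ⟨monomial c w :: es, by simp [← h', value], by simp [code]⟩
    · by_cases hi : i = 2
      · subst hi
        cases es with
        | nil => simp [runStep] at h'
        | cons e es =>
          simp only [runStep, if_true, List.map_cons, List.head?_cons, Option.map_some,
            Option.some.injEq, List.tail_cons] at h'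
          exact ⟨star e :: es, by simp [← h', value], by simp [code]⟩
      · rcases es with _ | ⟨e₂, _ | ⟨e₁, es⟩⟩
        · simp [runStep, hi] at h'
        · simp [runStep, hi] at h'
        · simp only [runStep, hi, if_false, List.map_cons, List.head?_cons, Option.bind_some,
            Option.map_some, Option.some.injEq, List.tail_cons] at h'
          rcases (by decide : ∀ i : Fin 3, i = 0 ∨ i = 1 ∨ i = 2) i with rfl | rfl | rfl
          · exact ⟨add e₁ e₂ :: es, by simp [← h', value], by simp [code]⟩
          · exact ⟨mul e₁ e₂ :: es, by simp [← h', value], by simp [code]⟩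
          · exact absurd rfl hi

theorem primrec_run {α : Type*} [Primcodable K] [Primcodable X] [Primcodable σ] [Primcodable α]
    {m : α → K × List (X × Bool) → σ} {f : α → Fin 3 × σ × σ → σ} {l : α → List (Symbol K X)}
    (hm : Primrec₂ m) (hf : Primrec₂ f) (hl : Primrec l) :
    Primrec fun a => run (m a) (f a) (l a) [] := by
  have e1 : Primrec₂ fun (q : (α × List σ) × Symbol K X) (p : K × List (X × Bool)) =>
      some (m q.1.1 p :: q.1.2) :=
    Primrec.option_some.comp (Primrec.list_cons.comp
      (hm.comp (Primrec.fst.comp (Primrec.fst.comp Primrec.fst)) Primrec.snd)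
      (Primrec.snd.comp (Primrec.fst.comp Primrec.fst)))
  have s1 : Primrec fun q : ((α × List σ) × Symbol K X) × Fin 3 => q.1.1.2 :=
    Primrec.snd.comp (Primrec.fst.comp Primrec.fst)
  have e2a : Primrec fun r : (((α × List σ) × Symbol K X) × Fin 3) × σ =>
      f r.1.1.1.1 (r.1.2, r.2, r.2) :=
    hf.comp (Primrec.fst.comp (Primrec.fst.comp (Primrec.fst.comp Primrec.fst)))
      ((Primrec.snd.comp Primrec.fst).pair (Primrec.snd.pair Primrec.snd))
  have e2b : Primrec fun r : (((α × List σ) × Symbol K X) × Fin 3) × σ =>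
      f r.1.1.1.1 (r.1.2, r.2, r.2) :: r.1.1.1.2.tail :=
    Primrec.list_cons.comp e2a (Primrec.list_tail.comp (s1.comp Primrec.fst))
  have e2 : Primrec fun q : ((α × List σ) × Symbol K X) × Fin 3 =>
      q.1.1.2.head?.map fun x => f q.1.1.1 (q.2, x, x) :: q.1.1.2.tail :=
    Primrec.option_map (Primrec.list_head?.comp s1) e2b.to₂
  have e3a : Primrec fun r : ((((α × List σ) × Symbol K X) × Fin 3) × σ) × σ =>
      f r.1.1.1.1.1 (r.1.1.2, r.2, r.1.2) :=
    hf.comp (Primrec.fst.comp (Primrec.fst.comp (Primrec.fst.comp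
        (Primrec.fst.comp Primrec.fst))))
      ((Primrec.snd.comp (Primrec.fst.comp Primrec.fst)).pair
        (Primrec.snd.pair (Primrec.snd.comp Primrec.fst)))
  have s2 : Primrec fun r : (((α × List σ) × Symbol K X) × Fin 3) × σ => r.1.1.1.2.tail :=
    Primrec.list_tail.comp (s1.comp Primrec.fst)
  have e3b : Primrec fun r : ((((α × List σ) × Symbol K X) × Fin 3) × σ) × σ =>
      f r.1.1.1.1.1 (r.1.1.2, r.2, r.1.2) :: r.1.1.1.1.2.tail.tail :=
    Primrec.list_cons.comp e3a (Primrec.list_tail.comp (s2.comp Primrec.fst))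
  have e3c : Primrec fun r : (((α × List σ) × Symbol K X) × Fin 3) × σ =>
      r.1.1.1.2.tail.head?.map fun y =>
        f r.1.1.1.1 (r.1.2, y, r.2) :: r.1.1.1.2.tail.tail :=
    Primrec.option_map (Primrec.list_head?.comp s2) e3b.to₂
  have e3 : Primrec fun q : ((α × List σ) × Symbol K X) × Fin 3 =>
      q.1.1.2.head?.bind fun x => q.1.1.2.tail.head?.map fun y =>
        f q.1.1.1 (q.2, y, x) :: q.1.1.2.tail.tail :=
    Primrec.option_bind (Primrec.list_head?.comp s1) e3c.to₂
  have e4 : Primrec fun q : (α × List σ) × Symbol K X => runStep (m q.1.1) (f q.1.1) q.1.2 q.2 :=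
    (Primrec.sumCasesOn Primrec.snd e1
      (Primrec.ite (Primrec.eq.comp Primrec.snd (Primrec.const 2)) e2 e3).to₂).of_eq
      fun q => by rcases q with ⟨q, p | i⟩ <;> rfl
  have e5 : Primrec₂ fun (a : α) (p : Option (List σ) × Symbol K X) =>
      p.1.bind fun s => runStep (m a) (f a) s p.2 :=
    Primrec.option_bind (Primrec.fst.comp Primrec.snd)
      (e4.comp (((Primrec.fst.comp Primrec.fst).pair Primrec.snd).pair
        (Primrec.snd.comp (Primrec.snd.comp Primrec.fst)))).to₂
  exact Primrec.list_foldl hl (Primrec.const (some [])) e5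

theorem primrec_codeSize [Primcodable K] [Primcodable X] :
    Primrec (codeSize : List (Symbol K X) → ℕ) := by
  have e1 : Primrec fun x : Symbol K X => Sum.elim (fun p => p.2.length + 1) (fun _ => 0) x :=
    (Primrec.sumCasesOn (f := fun x : Symbol K X => x) (g := fun _ p => p.2.length + 1)
      (h := fun _ _ => 0) Primrec.id
      (Primrec.succ.comp (Primrec.list_length.comp (Primrec.snd.comp Primrec.snd))).to₂
      (Primrec.const 0).to₂).of_eq fun x => by cases x <;> rfl
  refine (Primrec.list_foldr (Primrec.list_map Primrec.id (e1.comp Primrec.snd).to₂)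
    (Primrec.const 0) (Primrec.nat_add.comp (Primrec.fst.comp Primrec.snd)
      (Primrec.snd.comp Primrec.snd)).to₂).of_eq fun l => ?_
  rfl

end RatExpr

/-! ### The search for an expression without simplification -/

section Search

open FreeGroup RatExpr FGSeries
open Nat.Partrec (Code)
open Encodable (encode decode)

variable {K X : Type*} [Field K]

/-- The operations on analyses, indexed by the operation symbols. -/
def ExprInfo.op (p : Fin 3 × ExprInfo X × ExprInfo X) : ExprInfo X :=
  if p.1 = 0 then p.2.1.add p.2.2 else if p.1 = 1 then p.2.1.mul p.2.2 else p.2.1.star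

theorem RatExpr.value_info (e : RatExpr K X) :
    e.value (fun p => .ofMonomial (p.1 = 0) p.2.head? p.2.getLast? (IsReduced p.2)) ExprInfo.op =
      e.info := by
  induction e with
  | monomial c w => rfl
  | add e₁ e₂ h₁ h₂ => simp [value, h₁, h₂, ExprInfo.op, info]
  | mul e₁ e₂ h₁ h₂ => simp [value, h₁, h₂, ExprInfo.op, info]
  | star e h => simp [value, h, ExprInfo.op, info]

variable [DecidableEq X] [Finite X]

/-- Two well-defined expressions are equivalent if their coefficients agree on words that are not
too long. -/
theorem RatExpr.WellDefined.series_eq {e e' : RatExpr K X} (he : e.WellDefined)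
    (he' : e'.WellDefined) (h : ∀ w ∈ ballList X (Nat.card (X × Bool) *
      (codeSize e.code + codeSize e'.code)), e.series (mk w) = e'.series (mk w)) :
    e'.series = e.series := by
  have h1 := (he'.coneRankLE.const_mul (-1)).add he.coneRankLE
  have h2 := (h1.mono (add_comm _ _).le).eq_zero_of_short fun ω hω => by
    have := h _ (toWord_mem_ballList hω)
    rw [mk_toWord] at this
    simp [this]
  funext ω
  have := congrFun h2 ω
  simp only [neg_mul, one_mul, Pi.zero_apply, neg_add_eq_zero] at this
  exact this

variable [Primcodable K] [Primcodable X]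

/-- The written expressions that satisfy the syntactic criterion form a primitive recursive set. -/
theorem primrecPred_code_ok :
    PrimrecPred fun l : List (RatExpr.Symbol K X) => ∃ e : RatExpr K X, e.info.ok ∧ l = e.code := by
  classical
  obtain ⟨n, ⟨ε⟩⟩ := Finite.exists_equiv_fin (ExprInfo X)
  let _ : Primcodable (ExprInfo X) := Primcodable.ofEquiv (Fin n) ε
  have e1 : Primrec fun p : K × List (X × Bool) =>
      (decide (p.1 = 0), p.2.head?, p.2.getLast?, decide (IsReduced p.2)) := by
    have h1 : Primrec fun p : K × List (X × Bool) => p.2.getLast? :=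
      (Primrec.list_head?.comp (Primrec.list_reverse.comp Primrec.snd)).of_eq fun p => by simp
    exact (Primrec.eq.comp Primrec.fst (Primrec.const 0)).decide.pair
      ((Primrec.list_head?.comp Primrec.snd).pair
        (h1.pair (primrecPred_isReduced.comp Primrec.snd).decide))
  have e2 : Primrec fun p : K × List (X × Bool) =>
      ExprInfo.ofMonomial (p.1 = 0) p.2.head? p.2.getLast? (IsReduced p.2) :=
    ((Primrec.dom_finite fun q : Bool × Option (X × Bool) × Option (X × Bool) × Bool =>
      ExprInfo.ofMonomial (q.1 = true) q.2.1 q.2.2.1 (q.2.2.2 = true)).comp e1).of_eq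
      fun p => by simp
  have e3 : Primrec fun l : List (RatExpr.Symbol K X) =>
      run (fun p => .ofMonomial (p.1 = 0) p.2.head? p.2.getLast? (IsReduced p.2))
        ExprInfo.op l [] :=
    primrec_run (e2.comp Primrec.snd).to₂ ((Primrec.dom_finite ExprInfo.op).comp Primrec.snd).to₂
      Primrec.id
  -- The finitely many final stacks that indicate success.
  let S : List (Option (List (ExprInfo X))) :=
    ((Set.toFinite {I : ExprInfo X | I.ok}).toFinset.toList).map fun I => some [I]
  refine ((Primrec.eq.exists_mem_list).comp (Primrec.const S) e3).of_eq fun l => ?_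
  constructor
  · rintro ⟨o, ho, h⟩
    obtain ⟨I, hI, rfl⟩ := List.mem_map.1 ho
    obtain ⟨es, h1, rfl⟩ := exists_of_run _ _ h.symm
    obtain ⟨e, rfl, rfl⟩ := List.map_eq_singleton_iff.1 h1.symm
    refine ⟨e, ?_, by simp⟩
    rw [value_info] at hI
    simpa using hI
  · rintro ⟨e, he, rfl⟩
    refine ⟨some [e.info], List.mem_map.2 ⟨e.info, by simpa using he, rfl⟩, ?_⟩
    rw [run_code, value_info]

/-- The coefficients of well-defined expressions are computed by programs that depend primitive
recursively on a bound for the size and on the written expression. -/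
theorem exists_code_series (hK : IsComputableField K) :
    ∃ F : ℕ × List (RatExpr.Symbol K X) → Code, Primrec F ∧ ∀ (d : ℕ) (e : RatExpr K X),
      e.WellDefined → codeSize e.code ≤ d → Computes (F (d, e.code)) e.series := by
  obtain ⟨m, hm, hm'⟩ := exists_code_monomial (K := K) (X := X)
  obtain ⟨fa, ha, ha'⟩ := exists_code_add (X := X) hK
  obtain ⟨fm, hfm, hfm'⟩ := exists_code_mul (X := X) hK
  obtain ⟨fs, hs, hs'⟩ := exists_code_star (X := X) hK
  let f : ℕ → Fin 3 × Code × Code → Code := fun d p =>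
    if p.1 = 0 then fa p.2 else if p.1 = 1 then fm (Nat.card (X × Bool) * (d * d), p.2)
    else fs (Nat.card (X × Bool) * (d * d), p.2.1)
  have hB : Primrec fun q : ℕ × Fin 3 × Code × Code => Nat.card (X × Bool) * (q.1 * q.1) :=
    Primrec.nat_mul.comp (Primrec.const _) (Primrec.nat_mul.comp Primrec.fst Primrec.fst)
  have hf : Primrec₂ f :=
    Primrec.ite (Primrec.eq.comp (Primrec.fst.comp Primrec.snd) (Primrec.const 0))
      (ha.comp (Primrec.snd.comp Primrec.snd))
      (Primrec.ite (Primrec.eq.comp (Primrec.fst.comp Primrec.snd) (Primrec.const 1))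
        (hfm.comp (hB.pair (Primrec.snd.comp Primrec.snd)))
        (hs.comp (hB.pair (Primrec.fst.comp (Primrec.snd.comp Primrec.snd)))))
  have hrun : Primrec fun p : ℕ × List (RatExpr.Symbol K X) => run m (f p.1) p.2 [] :=
    primrec_run (hm.comp Primrec.snd).to₂ (hf.comp (Primrec.fst.comp Primrec.fst) Primrec.snd).to₂
      Primrec.snd
  refine ⟨fun p => ((run m (f p.1) p.2 []).bind List.head?).getD Code.zero, ?_, ?_⟩
  · exact Primrec.option_getD.comp (Primrec.option_bind hrun
      (Primrec.list_head?.comp Primrec.snd).to₂) (Primrec.const _)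
  · intro d e he hd
    have key : Computes (e.value m (f d)) e.series := by
      induction e with
      | monomial c w => exact hm' c w
      | add e₁ e₂ h₁ h₂ =>
        simp only [code, codeSize, List.map_append, List.sum_append] at hd h₁ h₂
        exact ha' _ _ _ _ (h₁ he.1 (by omega)) (h₂ he.2 (by omega))
      | mul e₁ e₂ h₁ h₂ =>
        simp only [code, codeSize, List.map_append, List.sum_append] at hd h₁ h₂
        exact hfm' _ _ _ _ _ (h₁ he.1 (by omega)) (h₂ he.2.1 (by omega)) fun α ω =>
          ConeRankLE.norm_le_of_mul_ne_zero (he.1.coneRankLE.mono (by rw [codeSize]; omega))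
            (he.2.1.coneRankLE.mono (by rw [codeSize]; omega)) he.2.2
      | star e h =>
        simp only [code, codeSize, List.map_append, List.sum_append] at hd h
        exact hs' d _ _ (h he.1 (by omega)) he.2 (he.1.coneRankLE.mono (by rw [codeSize]; omega))
    simpa [run_code] using key

end Search

theorem mainTheorem3 {K X : Type*} [Field K] [Finite X] [DecidableEq X] :
    (∀ e : RatExpr K X, e.WellDefined →
      ∃ e' : RatExpr K X, e'.WellDefined ∧ e'.WithoutSimplification ∧ e'.series = e.series) ∧
    (∀ [Primcodable K] [Primcodable X], IsComputableField K →
      ∃ f : List (RatExpr.Symbol K X) →. List (RatExpr.Symbol K X), Partrec f ∧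
        ∀ e : RatExpr K X, e.WellDefined →
          ∃ e' : RatExpr K X, e'.code ∈ f e.code ∧
            e'.WellDefined ∧ e'.WithoutSimplification ∧ e'.series = e.series) := by
  classical
  refine ⟨fun e he => ?_, ?_⟩
  · obtain ⟨e', h1, h2⟩ := he.exists_equivalent
    exact ⟨e', (RatExpr.of_info_ok h1).1, (RatExpr.of_info_ok h1).2.1, h2⟩
  intro _ _ hK
  obtain ⟨F, hF, hF'⟩ := exists_code_series (X := X) hK
  let ok : List (RatExpr.Symbol K X) → Prop := fun l => ∃ e : RatExpr K X, e.info.ok ∧ l = e.code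
  let size : List (RatExpr.Symbol K X) × List (RatExpr.Symbol K X) → ℕ := fun p =>
    RatExpr.codeSize p.1 + RatExpr.codeSize p.2
  have hsize : Primrec size := Primrec.nat_add.comp (RatExpr.primrec_codeSize.comp Primrec.fst)
    (RatExpr.primrec_codeSize.comp Primrec.snd)
  let agree : List (RatExpr.Symbol K X) × List (RatExpr.Symbol K X) → Part Bool := fun p =>
    agreePart (ballList X (Nat.card (X × Bool) * size p)) (evalCode K (F (size p, p.1)))
      (evalCode K (F (size p, p.2)))
  have hagree : Partrec agree := by
    refine Partrec.agreePart
      (l := fun p : List (RatExpr.Symbol K X) × List (RatExpr.Symbol K X) =>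
        ballList X (Nat.card (X × Bool) * size p))
      (f := fun p => evalCode K (F (size p, p.1))) (g := fun p => evalCode K (F (size p, p.2)))
      (primrec_ballList.comp (Primrec.nat_mul.comp (Primrec.const _) hsize)).to_comp ?_ ?_
    · exact partrec_evalCode.comp (hF.comp ((hsize.comp Primrec.fst).pair
        (Primrec.fst.comp Primrec.fst))).to_comp Computable.snd
    · exact partrec_evalCode.comp (hF.comp ((hsize.comp Primrec.fst).pair
        (Primrec.snd.comp Primrec.fst))).to_comp Computable.snd
  let search : List (RatExpr.Symbol K X) → ℕ → Part Bool := fun l n =>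
    Option.casesOn (Encodable.decode n : Option (List (RatExpr.Symbol K X))) (Part.some false)
      fun l' => cond (decide (ok l')) (agree (l, l')) (Part.some false)
  have hsearch : Partrec₂ search := by
    refine Partrec.optionCasesOn_right (Computable.decode.comp Computable.snd)
      (Computable.const false) ?_
    refine Partrec.cond (primrecPred_code_ok.decide.comp Primrec.snd).to_comp ?_
      (Computable.const false).partrec
    exact hagree.comp (((Computable.fst.comp Computable.fst).pair Computable.snd))
  refine ⟨fun l => (Nat.rfind (search l)).bind fun n =>
    (Encodable.decode n : Option (List (RatExpr.Symbol K X))),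
    (Partrec.rfind hsearch).bind (Computable.ofOption
      (Computable.decode.comp Computable.snd)).to₂, fun e he => ?_⟩
  have hagree' : ∀ e' : RatExpr K X, e'.WellDefined → agree (e.code, e'.code) =
      Part.some (decide (∀ w ∈ ballList X (Nat.card (X × Bool) *
        (RatExpr.codeSize e.code + RatExpr.codeSize e'.code)),
        e.series (FreeGroup.mk w) = e'.series (FreeGroup.mk w))) := fun e' he' =>
    agreePart_eq_some (fun w _ => hF' _ e he (Nat.le_add_right _ _) w)
      fun w _ => hF' _ e' he' (Nat.le_add_left _ _) w
  -- On a well-defined expression, every candidate is accepted or rejected in finite time.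
  have htotal : ∀ n, ∃ b, search e.code n = Part.some b := by
    intro n
    cases h1 : (Encodable.decode n : Option (List (RatExpr.Symbol K X))) with
    | none => exact ⟨false, by simp only [search, h1]⟩
    | some l' =>
      by_cases h2 : ok l'
      · obtain ⟨e', h3, rfl⟩ := h2
        refine ⟨_, Eq.trans ?_ (hagree' e' (RatExpr.of_info_ok h3).1)⟩
        simp only [search, h1, decide_eq_true (show ok e'.code from ⟨e', h3, rfl⟩), cond_true]
      · exact ⟨false, by simp only [search, h1, decide_eq_false h2, cond_false]⟩
  choose t ht using htotal
  obtain ⟨e₀, h1, h2⟩ := he.exists_equivalent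
  have h3 : t (Encodable.encode e₀.code) = true := by
    have h4 := ht (Encodable.encode e₀.code)
    simp only [search, Encodable.encodek, decide_eq_true (show ok e₀.code from ⟨e₀, h1, rfl⟩),
      cond_true, hagree' e₀ (RatExpr.of_info_ok h1).1, h2] at h4
    simpa using (Part.some_inj.1 h4).symm
  obtain ⟨n, hn, -⟩ := Nat.rfind_min' h3
  have hn' : t n = true := by simpa using Nat.rfind_spec hn
  have hfind : n ∈ Nat.rfind (search e.code) := by
    rw [show search e.code = fun n => Part.some (t n) from funext ht]
    exact hn
  have h4 := ht n
  rw [hn'] at h4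
  cases h5 : (Encodable.decode n : Option (List (RatExpr.Symbol K X))) with
  | none =>
    simp only [search, h5] at h4
    exact absurd (Part.some_inj.1 h4) (by simp)
  | some l' =>
    by_cases h6 : ok l'
    · obtain ⟨e', h7, rfl⟩ := h6
      obtain ⟨h8, h9, -⟩ := RatExpr.of_info_ok h7
      simp only [search, h5, decide_eq_true (show ok e'.code from ⟨e', h7, rfl⟩), cond_true,
        hagree' e' h8] at h4
      refine ⟨e', Part.mem_bind_iff.2 ⟨n, hfind, by simp [h5]⟩, h8, h9,
        he.series_eq h8 (of_decide_eq_true (Part.some_inj.1 h4))⟩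
    · simp only [search, h5, decide_eq_false h6, cond_false] at h4
      exact absurd (Part.some_inj.1 h4) (by simp)
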